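/- **Precise Recognition Theorem.** *Conventions.* Let $\mathbb{A}$ be a small category and $M : \mathbb{A}^{\mathrm{op}} \times \mathbb{A} \to \mathbf{Set}$ a functor; elements $m \in M(b,a)$ are called sectors and written $m : b \nrightarrow a$. For $Y : \mathbb{A}^{\mathrm{op}} \to \mathbf{Set}$ and $X : \mathbb{A} \to \mathbf{Set}$ (or $\mathbf{Top}$), let $Y \otimes X = \bigl(\sum_{b} Y(b) \times X(b)\bigr)/\!\sim$, where $\sim$ is the equivalence relation generated by $(yf, x) \sim (y, fx)$ for $f : b \to a$, $y \in Y(a)$, $x \in X(b)$ (with $Y(b)$ discrete and the quotient topology in the case of $\mathbf{Top}$); write $y \otimes x$ for the class of $(y,x)$, and $(M \otimes X)(a) = M(-,a) \otimes X$. A functor $X : \mathbb{A} \to \mathbf{Set}$ is *nondegenerate* if $- \otimes X : [\mathbb{A}^{\mathrm{op}}, \mathbf{Set}] \to \mathbf{Set}$ preserves finite connected limits; a functor $X : \mathbb{A} \to \mathbf{Top}$ is *nondegenerate* if its underlying $\mathbf{Set}$-valued functor is nondegenerate and $Xf$ is a closed map for every map $f$ of $\mathbb{A}$. The pair $(\mathbb{A},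 M)$ is an *equational system* if for each $a$ the category of elements of $M(-,a)$ is finite, and for each $b$ the functor $M(b,-)$ is nondegenerate. An *$M$-coalgebra in $\mathbf{Top}$* is a nondegenerate functor $X : \mathbb{A} \to \mathbf{Top}$ with a natural transformation $\xi : X \to M \otimes X$; a map $(X, \xi) \to (X', \xi')$ is a natural transformation $\omega : X \to X'$ with $\xi' \omega = (M \otimes \omega) \xi$. A *universal solution* of $(\mathbb{A}, M)$ in $\mathbf{Top}$ is a terminal $M$-coalgebra in $\mathbf{Top}$, and a *fixed point* of $M$ in $\mathbf{Top}$ is an $M$-coalgebra $(J, \gamma)$ in $\mathbf{Top}$ with $\gamma$ an isomorphism. For a fixed point $(J,\gamma)$ and a sector $m : b \nrightarrow a$, let $\psi_m : J(b) \to J(a)$, $\psi_m(t) = \gamma_a^{-1}(m \otimes t)$. A *complex* is an infinite sequence of sectors $\cdots \nrightarrow a_2 \overset{m_2}{\nrightarrow} a_1 \overset{m_1}{\nrightarrow} a_0$; for a finite sequence $a_n \overset{m_n}{\nrightarrow} \cdots \overset{m_1}{\nrightarrow} a_0$ put $$V^J_{m_1,\dots,m_n} = \psi_{m_1} \cdots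 \psi_{m_n} J(a_n) \subseteq J(a_0)$$ (so that $V^J = J(a_0)$ when $n = 0$). Call $J$ *occupied* if for every $a \in \mathbb{A}$ such that there is a complex with $a_0 = a$, the space $J(a)$ is nonempty. Compact spaces are not assumed to be Hausdorff. *Statement.* Let $(\mathbb{A}, M)$ be an equational system and let $(J, \gamma)$ be a fixed point of $M$ in $\mathbf{Top}$. The following are equivalent: 1. $(J, \gamma)$ is a universal solution of $(\mathbb{A}, M)$ in $\mathbf{Top}$; 2. $J$ is occupied, and for each $a \in \mathbb{A}$ the space $J(a)$ is compact and its topology is induced by a metric for which $$\inf_{n \in \mathbb{N}} \ \sup_{m_1, \dots, m_n} \operatorname{diam}\bigl(V^J_{m_1, \dots, m_n}\bigr) = 0,$$ where the supremum is over all sequences $a_n \overset{m_n}{\nrightarrow} \cdots \overset{m_1}{\nrightarrow} a_0 = a$ (a supremum over the empty set and the diameter of the empty set being $0$); 3. $J$ is occupied; for each $a \in \mathbb{A}$ the space $J(a)$ is compact; and for every complex $(a_\bullet, m_\bullet)$ the set $\bigcap_{n \in \mathbb{N}} V^J_{m_1, \dots, m_n}$ has at most one element. -/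

import Mathlib

open CategoryTheory CategoryTheory.Limits Opposite TopologicalSpace
open scoped ENNReal

universe u

namespace SelfSim

section Tensor

variable {A : Type u} [SmallCategory A]

/-! ### Tensor products of set- and space-valued functors -/

/-- The relation `(y f, x) ~ (y, f x)` on `∑ b, Y b × X b`, viewed as the sum of
copies of `X b`, one for each pair `(b, y)` with `y ∈ Y b`. -/
inductive TensorRel (Y : Aᵒᵖ ⥤ Type u) (X : A ⥤ Type u) :
    (Σ p : (Σ b : A, Y.obj (op b)), X.obj p.1) →
      (Σ p : (Σ b : A, Y.obj (op b)), X.obj p.1) → Prop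
  | intro {b a : A} (f : b ⟶ a) (y : Y.obj (op a)) (x : X.obj b) :
      TensorRel Y X ⟨⟨b, Y.map f.op y⟩, x⟩ ⟨⟨a, y⟩, X.map f x⟩

/-- The set `Y ⊗ X`: the quotient of `∑ b, Y b × X b` by the equivalence relation generated
by `(y f, x) ~ (y, f x)`. -/
def Tensor (Y : Aᵒᵖ ⥤ Type u) (X : A ⥤ Type u) : Type u :=
  Quot (TensorRel Y X)

namespace Tensor

/-- The element `y ⊗ x` of `Y ⊗ X`. -/
def mk {Y : Aᵒᵖ ⥤ Type u} {X : A ⥤ Type u} {b : A} (y : Y.obj (op b)) (x : X.obj b) :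
    Tensor Y X :=
  Quot.mk _ ⟨⟨b, y⟩, x⟩

theorem sound {Y : Aᵒᵖ ⥤ Type u} {X : A ⥤ Type u} {b a : A} (f : b ⟶ a)
    (y : Y.obj (op a)) (x : X.obj b) :
    (mk (Y.map f.op y) x : Tensor Y X) = mk y (X.map f x) :=
  Quot.sound (TensorRel.intro f y x)

theorem ind {Y : Aᵒᵖ ⥤ Type u} {X : A ⥤ Type u} {P : Tensor Y X → Prop}
    (h : ∀ (b : A) (y : Y.obj (op b)) (x : X.obj b), P (mk y x)) (t : Tensor Y X) : P t :=
  Quot.ind (fun s => h s.1.1 s.1.2 s.2) t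

/-- `y ⊗ x ↦ α(y) ⊗ β(x)`. -/
def map {Y Y' : Aᵒᵖ ⥤ Type u} {X X' : A ⥤ Type u} (α : Y ⟶ Y') (β : X ⟶ X') :
    Tensor Y X → Tensor Y' X' :=
  Quot.lift (fun s => mk (α.app (op s.1.1) s.1.2) (β.app s.1.1 s.2)) (by
    rintro _ _ ⟨f, y, x⟩
    have h₁ := NatTrans.naturality_apply α f.op y
    have h₂ := NatTrans.naturality_apply β f x
    simp only [h₁, h₂]
    exact sound f _ _)

theorem map_mk {Y Y' : Aᵒᵖ ⥤ Type u} {X X' : A ⥤ Type u} (α : Y ⟶ Y') (β : X ⟶ X') {b : A}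
    (y : Y.obj (op b)) (x : X.obj b) :
    map α β (mk y x) = mk (α.app (op b) y) (β.app b x) :=
  rfl

end Tensor

/-- The functor `- ⊗ X : [Aᵒᵖ, Set] ⥤ Set`. -/
def tensorWith (X : A ⥤ Type u) : (Aᵒᵖ ⥤ Type u) ⥤ Type u where
  obj Y := Tensor Y X
  map α := TypeCat.ofHom (Tensor.map α (𝟙 X))
  map_id Y := by
    ext t
    induction t using Tensor.ind
    rfl
  map_comp α β := by
    ext t
    induction t using Tensor.ind
    rfl

/-- `Y ⊗ X` for a space-valued functor `X` carries the quotient topology from the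
topological sum `∑ b, Y b × X b` with each `Y b` discrete. -/
instance tensorTopology (Y : Aᵒᵖ ⥤ Type u) (X : A ⥤ TopCat.{u}) :
    TopologicalSpace (Tensor Y (X ⋙ forget TopCat)) :=
  TopologicalSpace.coinduced
    (fun s : (Σ p : (Σ b : A, Y.obj (op b)), X.obj p.1) =>
      (Tensor.mk (X := X ⋙ forget TopCat) s.1.2 s.2 : Tensor Y (X ⋙ forget TopCat)))
    inferInstance

theorem Tensor.continuous_map {Y Y' : Aᵒᵖ ⥤ Type u} {X X' : A ⥤ TopCat.{u}} (α : Y ⟶ Y')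
    (β : X ⟶ X') :
    Continuous (Tensor.map α (Functor.whiskerRight β (forget TopCat))) := by
  refine continuous_coinduced_dom.2 (continuous_sigma fun p => ?_)
  have h₁ : Continuous (fun s : (Σ p : (Σ b : A, Y'.obj (op b)), X'.obj p.1) =>
      (Tensor.mk (X := X' ⋙ forget TopCat) s.1.2 s.2 :
        Tensor Y' (X' ⋙ forget TopCat))) := continuous_coinduced_rng
  have h₂ : Continuous (fun x : X'.obj p.1 =>
      (⟨⟨p.1, α.app (op p.1) p.2⟩, x⟩ : (Σ p : (Σ b : A, Y'.obj (op b)), X'.obj p.1))) :=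
    continuous_sigmaMk (σ := fun p : (Σ b : A, Y'.obj (op b)) => X'.obj p.1)
      (i := ⟨p.1, α.app (op p.1) p.2⟩)
  exact h₁.comp (h₂.comp (β.app p.1).hom.continuous)

/-- The bifunctor `(Y, X) ↦ Y ⊗ X` for space-valued `X`. -/
def topTensor : (Aᵒᵖ ⥤ Type u) ⥤ (A ⥤ TopCat.{u}) ⥤ TopCat.{u} where
  obj Y :=
    { obj := fun X => TopCat.of (Tensor Y (X ⋙ forget TopCat))
      map := fun β => TopCat.ofHom ⟨_, Tensor.continuous_map (𝟙 Y) β⟩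
      map_id := fun X => by
        ext t
        induction t using Tensor.ind
        rfl
      map_comp := fun β β' => by
        ext t
        induction t using Tensor.ind
        rfl }
  map α :=
    { app := fun X => TopCat.ofHom ⟨_, Tensor.continuous_map α (𝟙 X)⟩
      naturality := fun X X' β => by
        ext t
        induction t using Tensor.ind
        rfl }
  map_id Y := by
    ext X t
    induction t using Tensor.ind
    rfl
  map_comp α α' := by
    ext X t
    induction t using Tensor.ind
    rfl

/-! ### Nondegeneracy, finiteness, equational systems -/

/-- A set-valued functor `X` is nondegenerate if `- ⊗ X` preserves finite connected limits. -/
def SetNondegenerate (X : A ⥤ Type u) : Prop :=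
  ∀ (K : Type) [SmallCategory K] [FinCategory K] [IsConnected K],
    PreservesLimitsOfShape K (tensorWith X)

/-- A space-valued functor is nondegenerate if its underlying set-valued functor is and it
sends every map to a closed map. -/
def TopNondegenerate (X : A ⥤ TopCat.{u}) : Prop :=
  SetNondegenerate (X ⋙ forget TopCat) ∧ ∀ ⦃a b : A⦄ (f : a ⟶ b), IsClosedMap (X.map f)

/-- A presheaf is finite if its category of elements has finitely many objects and finitely
many maps. -/
def FinitePresheaf (Y : Aᵒᵖ ⥤ Type u) : Prop :=
  Finite Y.Elements ∧ ∀ p q : Y.Elements, Finite (p ⟶ q)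

/-- `(A, M)` is an equational system: each presheaf `M(-, a)` is finite and each functor
`M(b, -)` is nondegenerate.  Here `M(b, a)` is `(M.obj (op b)).obj a`. -/
structure IsEquationalSystem (M : Aᵒᵖ ⥤ A ⥤ Type u) : Prop where
  finite : ∀ a : A, FinitePresheaf (M.flip.obj a)
  nondegenerate : ∀ b : A, SetNondegenerate (M.obj (op b))

/-! ### Coalgebras -/

/-- The endofunctor `M ⊗ -` of `[A, Top]`, with `(M ⊗ X)(a) = M(-, a) ⊗ X`. -/
def moduleTensor (M : Aᵒᵖ ⥤ A ⥤ Type u) : (A ⥤ TopCat.{u}) ⥤ (A ⥤ TopCat.{u}) :=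
  topTensor.flip ⋙ (Functor.whiskeringLeft A (Aᵒᵖ ⥤ Type u) TopCat.{u}).obj M.flip

/-- The category of `M`-coalgebras in `Top`: objects are nondegenerate functors
`X : A ⥤ Top` with a natural transformation `X ⟶ M ⊗ X`, maps are natural transformations
commuting with the structure maps. -/
abbrev TopCoalgebra (M : Aᵒᵖ ⥤ A ⥤ Type u) :=
  ObjectProperty.FullSubcategory
    (fun X : Endofunctor.Coalgebra (moduleTensor M) => TopNondegenerate X.V)

/-- A universal solution in `Top` is a terminal object of the category of `M`-coalgebras
in `Top`. -/
def IsUniversalSolution {M : Aᵒᵖ ⥤ A ⥤ Type u} (J : TopCoalgebra M) : Prop :=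
  Nonempty (IsTerminal J)

/-- A fixed point is a coalgebra whose structure map is an isomorphism. -/
def IsFixedPoint {M : Aᵒᵖ ⥤ A ⥤ Type u} (J : TopCoalgebra M) : Prop :=
  IsIso J.obj.str

/-- The underlying functor of a coalgebra. -/
abbrev carrier {M : Aᵒᵖ ⥤ A ⥤ Type u} (J : TopCoalgebra M) : A ⥤ TopCat.{u} :=
  J.obj.V

/-! ### Complexes -/

/-- A complex `⋯ ⇸ a₂ ⇸ a₁ ⇸ a₀`; here `sec n : obj (n + 1) ⇸ obj n` is the sector usually
written `m_{n+1}`. -/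
structure Complex (M : Aᵒᵖ ⥤ A ⥤ Type u) where
  obj : ℕ → A
  sec : ∀ n : ℕ, (M.obj (op (obj (n + 1)))).obj (obj n)

/-- Truncated complexes `a_n ⇸ ⋯ ⇸ a₁ ⇸ a₀ = a` of length `n` ending at `a`. -/
inductive TruncComplex (M : Aᵒᵖ ⥤ A ⥤ Type u) : ℕ → A → Type u
  | nil (a : A) : TruncComplex M 0 a
  | cons {n : ℕ} {b a : A} (m : (M.obj (op b)).obj a) (c : TruncComplex M n b) :
      TruncComplex M (n + 1) a

/-- Drop `a₀` and the sector `m₁ : a₁ ⇸ a₀` from a complex. -/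
def Complex.tail {M : Aᵒᵖ ⥤ A ⥤ Type u} (c : Complex M) : Complex M where
  obj n := c.obj (n + 1)
  sec n := c.sec (n + 1)

/-- The truncation `a_n ⇸ ⋯ ⇸ a₀` of a complex. -/
def Complex.trunc {M : Aᵒᵖ ⥤ A ⥤ Type u} : (c : Complex M) → (n : ℕ) → TruncComplex M n (c.obj 0)
  | c, 0 => TruncComplex.nil (c.obj 0)
  | c, n + 1 => TruncComplex.cons (c.sec 0) (Complex.trunc c.tail n)

/-- `J` is occupied if `J a` is nonempty whenever some complex ends at `a`. -/
def Occupied {M : Aᵒᵖ ⥤ A ⥤ Type u} (J : TopCoalgebra M) : Prop :=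
  ∀ a : A, (∃ c : Complex M, c.obj 0 = a) → Nonempty ((carrier J).obj a)

/-- For a fixed point with structure map `γ` and a sector `m : b ⇸ a`, the map
`ψ_m : J b → J a`, `t ↦ γ⁻¹ (m ⊗ t)`. -/
noncomputable def sectorMap {M : Aᵒᵖ ⥤ A ⥤ Type u} (J : TopCoalgebra M)
    (hJ : IsFixedPoint J) {b a : A} (m : (M.obj (op b)).obj a) (t : (carrier J).obj b) :
    (carrier J).obj a :=
  haveI : IsIso J.obj.str := hJ
  (inv J.obj.str).app a
    (Tensor.mk (Y := M.flip.obj a) (X := carrier J ⋙ forget TopCat) m t :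
      Tensor (M.flip.obj a) (carrier J ⋙ forget TopCat))

/-- The subset `V_{m₁ … m_n} = ψ_{m₁} ⋯ ψ_{m_n} (J a_n)` of `J a₀`. -/
noncomputable def cell {M : Aᵒᵖ ⥤ A ⥤ Type u} (J : TopCoalgebra M) (hJ : IsFixedPoint J) :
    {n : ℕ} → {a : A} → TruncComplex M n a → Set ((carrier J).obj a)
  | _, _, TruncComplex.nil _ => Set.univ
  | _, _, TruncComplex.cons m c => sectorMap J hJ m '' cell J hJ c

/-- The space `J a` has a metric, inducing its topology, for which the infimum over `n` of
the largest diameter of a set `V_{m₁ … m_n}` in `J a` is zero. -/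
def HasShrinkingMetric {M : Aᵒᵖ ⥤ A ⥤ Type u} (J : TopCoalgebra M) (hJ : IsFixedPoint J)
    (a : A) : Prop :=
  ∃ d : MetricSpace ((carrier J).obj a),
    d.toUniformSpace.toTopologicalSpace = ((carrier J).obj a).str ∧
      (⨅ n : ℕ, ⨆ c : TruncComplex M n a,
        @Metric.ediam _ d.toPseudoEMetricSpace (cell J hJ c)) = (0 : ℝ≥0∞)

end Tensor

end SelfSim

/-!
Call a *cell* of a coalgebra `X` at `a`, for a truncated complex `m₁, …, m_n` ending at `a`, the set
of points of `X a` that can be resolved along it: `ξ x = m₁ ⊗ x₁`, `ξ x₁ = m₂ ⊗ x₂`, and so on. For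
the fixed point `J` these are the sets `V`.  There are finitely many cells of each level `n`, they
cover `X a`, and they are closed, because tensoring with a finite presheaf makes every map
`y ⊗ - : X b → Y ⊗ X` closed (`Tensor.isClosedMap_mk`).  Nondegeneracy enters only through the
fact that `m ⊗ x = m' ⊗ x'` is always witnessed by one span (`Tensor.exists_span_of_mk_eq`), which
lets resolutions be lifted along maps.  Finiteness enters through König's lemma.  The cells of `X`
are *thin* if those along an infinite complex have at most one common point (`HasThinCells`).

*Thin cells imply terminality.*  A coalgebra map `X ⟶ J` has to send each point `x` to a point in
all cells of `J` whose counterparts contain `x`.  By compactness such a point exists, and thinness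
makes it unique; this defines the map (`isUniversalSolution_of_hasThinCells`).  It is continuous
by compactness and König's lemma (`continuous_of_shadows`).

*Thin cells and metrics.*  When the cells are thin, the complements of finite unions of cells form
a countable basis and `J a` is regular, so Urysohn's theorem provides a metric; the diameters tend
to zero by compactness.  The converse is immediate.

*Terminality implies thin cells and compactness.*  Resolutions along a complex `c` are the coalgebra
maps out of the discrete coalgebra `∑ n, A(c n, -)`, so for terminal `J` there is exactly one, and
`J` is occupied. A point in all cells along `c` and an arbitrary resolution of it, along `k` say,
yield by König's lemma a complex over both `c` and `k`, and uniqueness of resolutions identifies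
the point with the start of the resolution along `c`
(`IsUniversalSolution.eq_of_mem_levelCell`).  For compactness, each `J a` is given the quotient
topology from the profinite space of complexes ending at `a`.  This is a compact topology which
again makes `J` a coalgebra, and the unique coalgebra map from it to `J` is the identity on points,
so `J a` is a continuous image of a compact space (`IsUniversalSolution.compactSpace`).
-/

namespace SelfSim

/-! ### Nondegenerate functors and equality in tensor products -/

section Nondegenerate

variable {A : Type u} [SmallCategory A]

/-- The evaluation `yoneda a ⊗ X → X a`, `f ⊗ x ↦ f x` (one half of the Yoneda isomorphism). -/
def Tensor.yonedaEval (X : A ⥤ Type u) (a : A) : Tensor (yoneda.obj a) X → X.obj a :=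
  Quot.lift (fun s => X.map (Y := a) s.1.2 s.2) (by
    rintro _ _ ⟨f, y, x⟩
    exact congrArg (fun h => h x) (X.map_comp f y))

/-- Preservation of the pullback of a cospan of representables says that the category of elements
of `X` has a span over each of its cospans. -/
theorem SetNondegenerate.exists_span {X : A ⥤ Type u} (hX : SetNondegenerate X) {a a' c : A}
    (f : a ⟶ c) (f' : a' ⟶ c) (x : X.obj a) (x' : X.obj a') (h : X.map f x = X.map f' x') :
    ∃ (b : A) (g : b ⟶ a) (g' : b ⟶ a') (y : X.obj b),
      g ≫ f = g' ≫ f' ∧ X.map g y = x ∧ X.map g' y = x' := by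
  have := hX WalkingCospan
  have hp := (IsPullback.of_hasPullback (yoneda.map f) (yoneda.map f')).map (tensorWith X)
  obtain ⟨t, h₁, h₂⟩ := Types.exists_of_isPullback hp
    (Tensor.mk (Y := yoneda.obj a) (X := X) (𝟙 a) x)
    (Tensor.mk (Y := yoneda.obj a') (X := X) (𝟙 a') x') (by
      change Tensor.mk (Y := yoneda.obj c) (X := X) (𝟙 a ≫ f) x =
        Tensor.mk (Y := yoneda.obj c) (X := X) (𝟙 a' ≫ f') x'
      have e₁ := Tensor.sound (Y := yoneda.obj c) (X := X) f (𝟙 c) x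
      have e₂ := Tensor.sound (Y := yoneda.obj c) (X := X) f' (𝟙 c) x'
      rw [← h, ← e₁] at e₂
      simpa using e₂.symm)
  induction t using Tensor.ind with
  | h b y z =>
    refine ⟨b, (pullback.fst (yoneda.map f) (yoneda.map f')).app (op b) y,
      (pullback.snd (yoneda.map f) (yoneda.map f')).app (op b) y, z, ?_, ?_, ?_⟩
    · exact congrArg (fun k => k.app (op b) y)
        (pullback.condition (f := yoneda.map f) (g := yoneda.map f'))
    · have := congrArg (Tensor.yonedaEval X a) h₁
      exact this.trans (by simp [Tensor.yonedaEval, Tensor.mk])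
    · have := congrArg (Tensor.yonedaEval X a') h₂
      exact this.trans (by simp [Tensor.yonedaEval, Tensor.mk])

/-- For nondegenerate `X`, two elements of `Y ⊗ X` agree only if a single span identifies them. -/
theorem Tensor.exists_span_of_mk_eq {Y : Aᵒᵖ ⥤ Type u} {X : A ⥤ Type u} (hX : SetNondegenerate X)
    {b b' : A} {y : Y.obj (op b)} {y' : Y.obj (op b')} {x : X.obj b} {x' : X.obj b'}
    (h : (Tensor.mk y x : Tensor Y X) = Tensor.mk y' x') :
    ∃ (c : A) (g : c ⟶ b) (g' : c ⟶ b') (z : X.obj c),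
      Y.map g.op y = Y.map g'.op y' ∧ X.map g z = x ∧ X.map g' z = x' := by
  have key : ∀ s s' : (Σ p : (Σ b : A, Y.obj (op b)), X.obj p.1),
      Relation.EqvGen (TensorRel Y X) s s' →
      ∃ (c : A) (g : c ⟶ s.1.1) (g' : c ⟶ s'.1.1) (z : X.obj c),
        Y.map g.op s.1.2 = Y.map g'.op s'.1.2 ∧ X.map g z = s.2 ∧ X.map g' z = s'.2 := by
    intro s s' hs
    induction hs with
    | rel _ _ hr =>
      obtain ⟨f, y, x⟩ := hr
      exact ⟨_, 𝟙 _, f, x, by simp, by simp, rfl⟩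
    | refl s => exact ⟨_, 𝟙 _, 𝟙 _, s.2, rfl, by simp, by simp⟩
    | symm _ _ _ ih =>
      obtain ⟨c, g, g', z, h₁, h₂, h₃⟩ := ih
      exact ⟨c, g', g, z, h₁.symm, h₃, h₂⟩
    | trans _ s₁ _ _ _ ih₁ ih₂ =>
      obtain ⟨c, g, g', z, h₁, h₂, h₃⟩ := ih₁
      obtain ⟨d, k, k', w, h₄, h₅, h₆⟩ := ih₂
      obtain ⟨e, l, l', v, h₇, h₈, h₉⟩ := hX.exists_span g' k z w (h₃.trans h₅.symm)
      refine ⟨e, l ≫ g, l' ≫ k', v, ?_, ?_, ?_⟩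
      · have e₁ := congrArg (fun q => Y.map q.op s₁.1.2) h₇
        simp only [op_comp, Functor.map_comp, types_comp_apply] at e₁ ⊢
        exact ((congrArg (Y.map l.op) h₁).trans e₁).trans (congrArg (Y.map l'.op) h₄)
      · simp [h₈, h₂]
      · simp [h₉, h₆]
  exact key _ _ (Quot.eqvGen_exact h)

theorem SetNondegenerate.of_iso {X X' : A ⥤ Type u} (e : X ≅ X') (hX : SetNondegenerate X) :
    SetNondegenerate X' := by
  intro K _ _ _
  have := hX K
  refine preservesLimitsOfShape_of_natIso (F := tensorWith X) (NatIso.ofComponents (fun Y =>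
    { hom := TypeCat.ofHom (Tensor.map (𝟙 Y) e.hom)
      inv := TypeCat.ofHom (Tensor.map (𝟙 Y) e.inv)
      hom_inv_id := ?_
      inv_hom_id := ?_ }) ?_)
  · ext t
    induction t using Tensor.ind with
    | h b y x =>
      change Tensor.mk y (e.inv.app b (e.hom.app b x)) = Tensor.mk y x
      simp
  · ext t
    induction t using Tensor.ind with
    | h b y x =>
      change Tensor.mk y (e.hom.app b (e.inv.app b x)) = Tensor.mk y x
      simp
  · intro Y Y' f
    ext t
    induction t using Tensor.ind
    rfl

/-- A coproduct of representables `a ↦ ∑ i, A(d i, a)`. -/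
@[simps]
def sumCorepresentable {I : Type} (d : I → A) : A ⥤ Type u where
  obj a := Σ i, (d i ⟶ a)
  map f := TypeCat.ofHom fun s => ⟨s.1, s.2 ≫ f⟩

/-- The functor `Y ↦ ∑ i, Y (d i)`. -/
@[simps]
def sumEval {I : Type} (d : I → A) : (Aᵒᵖ ⥤ Type u) ⥤ Type u where
  obj Y := Σ i, Y.obj (op (d i))
  map α := TypeCat.ofHom fun s => ⟨s.1, α.app _ s.2⟩

/-- Tensoring with a coproduct of representables is a coproduct of evaluations. -/
def tensorSumCorepresentableIso {I : Type} (d : I → A) :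
    sumEval d ≅ tensorWith (sumCorepresentable d) :=
  NatIso.ofComponents (fun Y =>
    { hom := TypeCat.ofHom fun s => Tensor.mk (X := sumCorepresentable d) s.2 ⟨s.1, 𝟙 _⟩
      inv := TypeCat.ofHom (Quot.lift (fun s => ⟨s.2.1, Y.map s.2.2.op s.1.2⟩) (by
        rintro _ _ ⟨f, y, x⟩
        exact congrArg (fun h => (⟨x.1, h y⟩ : Σ i, Y.obj (op (d i))))
          (Y.map_comp f.op x.2.op).symm))
      hom_inv_id := by
        ext s
        exact congrArg (fun h => (⟨s.1, h s.2⟩ : Σ i, Y.obj (op (d i)))) (Y.map_id _)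
      inv_hom_id := by
        ext t
        induction t using Tensor.ind with
        | h b y x =>
          change Tensor.mk (X := sumCorepresentable d) (Y.map x.2.op y) ⟨x.1, 𝟙 _⟩ =
            Tensor.mk y x
          refine (Tensor.sound (X := sumCorepresentable d) x.2 y ⟨x.1, 𝟙 _⟩).trans ?_
          exact congrArg (fun k => Tensor.mk (X := sumCorepresentable d) y ⟨x.1, k⟩)
            (Category.id_comp x.2) }) (by
    intro Y Y' f
    ext s
    rfl)

/-- A coproduct of sets commutes with connected limits, since the components of a compatible
family over a connected category all have the same index. -/
theorem setNondegenerate_sumCorepresentable {I : Type} (d : I → A) :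
    SetNondegenerate (sumCorepresentable d) := by
  intro K _ _ _
  suffices PreservesLimitsOfShape K (sumEval d) from
    preservesLimitsOfShape_of_natIso (tensorSumCorepresentableIso d)
  refine ⟨fun {F} => ⟨fun {c} hc => ⟨?_⟩⟩⟩
  refine Classical.choice ((Types.isLimit_iff _).2 fun s hs => ?_)
  have hev : ∀ i, IsLimit (((evaluation Aᵒᵖ (Type u)).obj (op (d i))).mapCone c) := fun i =>
    isLimitOfPreserves _ hc
  obtain ⟨k₀⟩ : Nonempty K := inferInstance
  have hfst : ∀ k, (s k).1 = (s k₀).1 := fun k =>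
    constant_of_preserves_morphisms (fun k => (s k).1)
      (fun k k' f => (congrArg Sigma.fst (hs f) :)) k k₀
  have hsec : ∃ (i : I) (v : ∀ k, (F.obj k).obj (op (d i))), ∀ k, s k = ⟨i, v k⟩ := by
    refine ⟨(s k₀).1, fun k => hfst k ▸ (s k).2, fun k => ?_⟩
    refine Sigma.ext (hfst k) ?_
    simp
  obtain ⟨i, v, hv⟩ := hsec
  have hvs : ∀ {k k'} (f : k ⟶ k'), (F.map f).app (op (d i)) (v k) = v k' := by
    intro k k' f
    have := hs f
    rw [hv k, hv k'] at this
    exact eq_of_heq (Sigma.mk.inj_iff.1 this).2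
  obtain ⟨w, hw, huniq⟩ := (Types.isLimit_iff _).1 ⟨hev i⟩ v (fun f => hvs f)
  refine ⟨⟨i, w⟩, fun k => ?_, ?_⟩
  · rw [hv k]
    exact congrArg (Sigma.mk i) (hw k)
  · rintro ⟨j, w'⟩ hw'
    have h₀ := (hw' k₀).trans (hv k₀)
    obtain rfl : j = i := congrArg Sigma.fst h₀
    refine congrArg (Sigma.mk j) (huniq w' fun k => ?_)
    exact eq_of_heq (Sigma.mk.inj_iff.1 ((hw' k).trans (hv k))).2

end Nondegenerate

/-! ### Closed maps into tensor products -/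

section Closed

variable {A : Type u} [SmallCategory A]

theorem Tensor.continuous_mk {Y : Aᵒᵖ ⥤ Type u} {X : A ⥤ TopCat.{u}} {b : A} (y : Y.obj (op b)) :
    Continuous (fun x : X.obj b =>
      (Tensor.mk (X := X ⋙ forget TopCat) y x : Tensor Y (X ⋙ forget TopCat))) := by
  have h₁ : Continuous (fun s : (Σ p : (Σ b : A, Y.obj (op b)), X.obj p.1) =>
      (Tensor.mk (X := X ⋙ forget TopCat) s.1.2 s.2 : Tensor Y (X ⋙ forget TopCat))) :=
    continuous_coinduced_rng
  exact h₁.comp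
    (continuous_sigmaMk (σ := fun p : (Σ b : A, Y.obj (op b)) => X.obj p.1) (i := ⟨b, y⟩))

theorem Tensor.isClosed_iff {Y : Aᵒᵖ ⥤ Type u} {X : A ⥤ TopCat.{u}}
    {D : Set (Tensor Y (X ⋙ forget TopCat))} :
    IsClosed D ↔ ∀ (b : A) (y : Y.obj (op b)), IsClosed {x : X.obj b |
      (Tensor.mk (X := X ⋙ forget TopCat) y x : Tensor Y (X ⋙ forget TopCat)) ∈ D} := by
  refine ⟨fun h b y => h.preimage (Tensor.continuous_mk y), fun h => ?_⟩
  let q : (Σ p : (Σ b : A, Y.obj (op b)), X.obj p.1) → Tensor Y (X ⋙ forget TopCat) :=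
    fun s => Tensor.mk (X := X ⋙ forget TopCat) s.1.2 s.2
  have h' : IsClosed (q ⁻¹' D) := isClosed_sigma_iff.2 fun p => h p.1 p.2
  exact isClosed_coinduced.2 h'

/-- The preimage of `y ⊗ C` under `y' ⊗ -` is the union of the sets `g' (g ⁻¹ C)` over the spans
`b ← c → b'` that identify `y` and `y'`.  These spans form a finite family as far as the element
over `c` is concerned, so the union is closed. -/
theorem Tensor.isClosedMap_mk {Y : Aᵒᵖ ⥤ Type u} (hY : FinitePresheaf Y) {X : A ⥤ TopCat.{u}}
    (hX : TopNondegenerate X) {b : A} (y : Y.obj (op b)) :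
    IsClosedMap (fun x : X.obj b =>
      (Tensor.mk (X := X ⋙ forget TopCat) y x : Tensor Y (X ⋙ forget TopCat))) := by
  intro C hC
  refine Tensor.isClosed_iff.2 fun b' y' => ?_
  have := hY.1
  have := hY.2
  let P (b : A) (y : Y.obj (op b)) : Y.Elements := ⟨op b, y⟩
  let S := Σ e : Y.Elements, (P b y ⟶ e) × (P b' y' ⟶ e)
  have : {x : X.obj b' | (Tensor.mk (X := X ⋙ forget TopCat) y' x : Tensor Y (X ⋙ forget TopCat)) ∈
      (fun x : X.obj b => (Tensor.mk (X := X ⋙ forget TopCat) y x :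
        Tensor Y (X ⋙ forget TopCat))) '' C} =
      ⋃ s : S, X.map s.2.2.1.unop '' (X.map s.2.1.1.unop ⁻¹' C) := by
    ext x'
    simp only [Set.mem_ofPred_eq, Set.mem_iUnion]
    constructor
    · rintro ⟨x, hx, he⟩
      obtain ⟨c, g, g', z, h₁, rfl, rfl⟩ := Tensor.exists_span_of_mk_eq hX.1 he
      exact ⟨⟨P c (Y.map g.op y), ⟨g.op, rfl⟩, ⟨g'.op, h₁.symm⟩⟩, z, hx, rfl⟩
    · rintro ⟨⟨⟨c, w⟩, ⟨g, hg⟩, ⟨g', hg'⟩⟩, z, hz, rfl⟩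
      refine ⟨_, hz, ?_⟩
      have e₁ := Tensor.sound (X := X ⋙ forget TopCat) g.unop y z
      have e₂ := Tensor.sound (X := X ⋙ forget TopCat) g'.unop y' z
      have e₃ : Y.map g.unop.op y = Y.map g'.unop.op y' := hg.trans hg'.symm
      rw [e₃] at e₁
      exact e₁.symm.trans e₂
  rw [this]
  exact isClosed_iUnion_of_finite fun s =>
    hX.2 _ _ (hC.preimage (X.map s.2.1.1.unop).hom.continuous)

end Closed

/-! ### Sectors and resolutions of points of a coalgebra -/

section Resolutions

variable {A : Type u} [SmallCategory A] {M : Aᵒᵖ ⥤ A ⥤ Type u}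

/-- The set of sectors `b ⇸ a`. -/
abbrev Sector (M : Aᵒᵖ ⥤ A ⥤ Type u) (b a : A) : Type u := (M.obj (op b)).obj a

/-- The sector `f m : b ⇸ a'`, for `m : b ⇸ a` and `f : a ⟶ a'`. -/
def Sector.push {b a a' : A} (f : a ⟶ a') (m : Sector M b a) : Sector M b a' :=
  (M.obj (op b)).map f m

/-- The sector `m g : b' ⇸ a`, for `m : b ⇸ a` and `g : b' ⟶ b`. -/
def Sector.pull {b b' a : A} (g : b' ⟶ b) (m : Sector M b a) : Sector M b' a :=
  (M.map g.op).app a m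

theorem Sector.push_id {b a : A} (m : Sector M b a) : m.push (𝟙 a) = m := by
  simp [Sector.push]

theorem Sector.push_comp {b a a' a'' : A} (f : a ⟶ a') (g : a' ⟶ a'') (m : Sector M b a) :
    m.push (f ≫ g) = (m.push f).push g := by
  simp [Sector.push]

theorem Sector.pull_comp {b b' b'' a : A} (g : b' ⟶ b) (h : b'' ⟶ b') (m : Sector M b a) :
    m.pull (h ≫ g) = (m.pull g).pull h := by
  simp [Sector.pull]

theorem Sector.push_pull {b b' a a' : A} (f : a ⟶ a') (g : b' ⟶ b) (m : Sector M b a) :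
    (m.pull g).push f = (m.push f).pull g :=
  (NatTrans.naturality_apply (M.map g.op) f m).symm

theorem IsEquationalSystem.finite_sectors (hM : IsEquationalSystem M) (a : A) :
    Finite (Σ b, Sector M b a) := by
  have : Finite (M.flip.obj a).Elements := (hM.finite a).1
  exact Finite.of_injective
    (β := (M.flip.obj a).Elements)
    (fun s : Σ b, Sector M b a => ⟨op s.1, s.2⟩)
    (by rintro ⟨b, m⟩ ⟨b', m'⟩ h; cases h; rfl)

theorem IsEquationalSystem.finite_pull (hM : IsEquationalSystem M) {b b' a : A}
    (m : Sector M b a) (m' : Sector M b' a) : {g : b' ⟶ b | m.pull g = m'}.Finite := by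
  let P (b : A) (m : Sector M b a) : (M.flip.obj a).Elements := ⟨op b, m⟩
  have := (hM.finite a).2 (P b m) (P b' m')
  exact Set.finite_coe_iff.1 <| Finite.of_injective
    (fun g : {g : b' ⟶ b | m.pull g = m'} => (⟨g.1.op, g.2⟩ : P b m ⟶ P b' m'))
    (by rintro ⟨g, hg⟩ ⟨g', hg'⟩ h; exact Subtype.ext (Quiver.Hom.op_inj (congrArg Subtype.val h)))

/-- The structure map `X a → M(-, a) ⊗ X` as a plain function. -/
def toTensor (X : Endofunctor.Coalgebra (moduleTensor M)) (a : A) (x : X.V.obj a) :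
    Tensor (M.flip.obj a) (X.V ⋙ forget TopCat) :=
  X.str.app a x

theorem continuous_toTensor (X : Endofunctor.Coalgebra (moduleTensor M)) (a : A) :
    Continuous (toTensor X a) :=
  (X.str.app a).hom.continuous

/-- `Resolves X m x t` says that the structure map sends `x` to `m ⊗ t`. -/
def Resolves (X : Endofunctor.Coalgebra (moduleTensor M)) {b a : A} (m : Sector M b a)
    (x : X.V.obj a) (t : X.V.obj b) : Prop :=
  toTensor X a x = Tensor.mk (Y := M.flip.obj a) (X := X.V ⋙ forget TopCat) m t

variable {X : Endofunctor.Coalgebra (moduleTensor M)}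

theorem exists_resolves {a : A} (x : X.V.obj a) :
    ∃ (b : A) (m : Sector M b a) (t : X.V.obj b), Resolves X m x t := by
  have : ∀ s : Tensor (M.flip.obj a) (X.V ⋙ forget TopCat), ∃ (b : A) (m : Sector M b a)
      (t : X.V.obj b), s = Tensor.mk (Y := M.flip.obj a) (X := X.V ⋙ forget TopCat) m t := by
    intro s
    induction s using Tensor.ind with
    | h b m t => exact ⟨b, m, t, rfl⟩
  exact this _

theorem toTensor_map {a a' : A} (f : a ⟶ a') (x : X.V.obj a) :
    toTensor X a' (X.V.map f x) = Tensor.map (M.flip.map f) (𝟙 _) (toTensor X a x) :=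
  (NatTrans.naturality_apply X.str f x)

theorem Resolves.map {b a a' : A} {m : Sector M b a} {x : X.V.obj a} {t : X.V.obj b}
    (h : Resolves X m x t) (f : a ⟶ a') : Resolves X (m.push f) (X.V.map f x) t := by
  unfold Resolves at h ⊢
  rw [toTensor_map, h]
  rfl

theorem resolves_pull {b b' a : A} {m : Sector M b a} {x : X.V.obj a} {t : X.V.obj b'}
    (g : b' ⟶ b) : Resolves X (m.pull g) x t ↔ Resolves X m x (X.V.map g t) := by
  have := Tensor.sound (Y := M.flip.obj a) (X := X.V ⋙ forget TopCat) g m t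
  unfold Resolves
  exact ⟨fun h => h.trans this, fun h => h.trans this.symm⟩

theorem Resolves.exists_span (hX : TopNondegenerate X.V) {b b' a : A} {m : Sector M b a}
    {m' : Sector M b' a} {x : X.V.obj a} {t : X.V.obj b} {t' : X.V.obj b'}
    (h : Resolves X m x t) (h' : Resolves X m' x t') :
    ∃ (c : A) (g : c ⟶ b) (g' : c ⟶ b') (z : X.V.obj c),
      m.pull g = m'.pull g' ∧ X.V.map g z = t ∧ X.V.map g' z = t' :=
  Tensor.exists_span_of_mk_eq (Y := M.flip.obj a) hX.1 (h.symm.trans h')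

/-- If `z` lies over a point resolved by `m`, then some resolution of `z` lies over it. -/
theorem Resolves.lift (hX : TopNondegenerate X.V) {b a c : A} {m : Sector M b a} {g : c ⟶ a}
    {z : X.V.obj c} {t : X.V.obj b} (h : Resolves X m (X.V.map g z) t) :
    ∃ (d : A) (l : Sector M d c) (k : d ⟶ b) (w : X.V.obj d),
      Resolves X l z w ∧ X.V.map k w = t ∧ l.push g = m.pull k := by
  obtain ⟨d, l, w, hl⟩ := exists_resolves z
  obtain ⟨e, p, q, v, h₁, rfl, rfl⟩ := (hl.map g).exists_span hX h
  exact ⟨e, l.pull p, q, v, (resolves_pull p).2 hl, rfl, (Sector.push_pull g p l).trans h₁⟩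

/-- If `z` lies over two resolved points, then some resolution of `z` lies over both. -/
theorem Resolves.lift₂ (hX : TopNondegenerate X.V) {b b' a a' c : A} {m : Sector M b a}
    {m' : Sector M b' a'} {g : c ⟶ a} {g' : c ⟶ a'} {z : X.V.obj c} {t : X.V.obj b}
    {t' : X.V.obj b'} (h : Resolves X m (X.V.map g z) t) (h' : Resolves X m' (X.V.map g' z) t') :
    ∃ (d : A) (l : Sector M d c) (k : d ⟶ b) (k' : d ⟶ b') (w : X.V.obj d),
      Resolves X l z w ∧ X.V.map k w = t ∧ X.V.map k' w = t' ∧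
        l.push g = m.pull k ∧ l.push g' = m'.pull k' := by
  obtain ⟨d, l, k, w, hl, rfl, hg⟩ := h.lift hX
  obtain ⟨e, p, q, v, h₁, rfl, rfl⟩ := (hl.map g').exists_span hX h'
  refine ⟨e, l.pull p, p ≫ k, q, v, (resolves_pull p).2 hl, by simp, rfl, ?_, ?_⟩
  · rw [Sector.push_pull, hg, Sector.pull_comp]
  · rw [Sector.push_pull, h₁]

/-- Coalgebra maps preserve resolutions. -/
theorem Resolves.hom {Y : Endofunctor.Coalgebra (moduleTensor M)} (ω : X ⟶ Y) {b a : A}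
    {m : Sector M b a} {x : X.V.obj a} {t : X.V.obj b} (h : Resolves X m x t) :
    Resolves Y m (ω.f.app a x) (ω.f.app b t) := by
  have e : toTensor Y a (ω.f.app a x) =
      Tensor.map (𝟙 _) (Functor.whiskerRight ω.f (forget TopCat)) (toTensor X a x) :=
    (congrArg (fun k => k.app a x) ω.h).symm
  unfold Resolves at h ⊢
  rw [e, h]
  rfl

/-- A natural transformation is a coalgebra map if it preserves one resolution of each point. -/
def coalgebraHomMk {X Y : TopCoalgebra M} (ω : X.obj.V ⟶ Y.obj.V)
    (h : ∀ (a : A) (x : X.obj.V.obj a), ∃ (b : A) (m : Sector M b a) (t : X.obj.V.obj b),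
      Resolves X.obj m x t ∧ Resolves Y.obj m (ω.app a x) (ω.app b t)) : X ⟶ Y :=
  ObjectProperty.homMk
    { f := ω
      h := by
        ext a x
        obtain ⟨b, m, t, h₁, h₂⟩ := h a x
        change Tensor.map (𝟙 _) (Functor.whiskerRight ω (forget TopCat)) (toTensor X.obj a x) =
          toTensor Y.obj a (ω.app a x)
        unfold Resolves at h₁ h₂
        rw [h₁, h₂]
        rfl }

variable {J : TopCoalgebra M}

theorem resolves_sectorMap (hJ : IsFixedPoint J) {b a : A} (m : Sector M b a)
    (t : J.obj.V.obj b) : Resolves J.obj m (sectorMap J hJ m t) t := by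
  have : IsIso J.obj.str := hJ
  have h := congrArg (fun k => k.app a) (IsIso.inv_hom_id J.obj.str)
  exact congrArg (fun k => k (Tensor.mk (Y := M.flip.obj a) (X := carrier J ⋙ forget TopCat) m t :
      Tensor (M.flip.obj a) (carrier J ⋙ forget TopCat))) h

theorem toTensor_injective (hJ : IsFixedPoint J) (a : A) :
    Function.Injective (toTensor J.obj a) := by
  have : IsIso J.obj.str := hJ
  have h := congrArg (fun k => k.app a) (IsIso.hom_inv_id J.obj.str)
  exact Function.LeftInverse.injective (g := (inv J.obj.str).app a)
    fun x => congrArg (fun k => k x) h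

theorem Resolves.unique (hJ : IsFixedPoint J) {b a : A} {m : Sector M b a}
    {x y : J.obj.V.obj a} {t : J.obj.V.obj b} (h : Resolves J.obj m x t)
    (h' : Resolves J.obj m y t) : x = y :=
  toTensor_injective hJ a (h.trans h'.symm)

end Resolutions

/-! ### König's lemma -/

section Konig

/-- There is a chain of `k` steps that starts at the given state. -/
def HasChain {S : ℕ → Type*} (step : ∀ n, S n → S (n + 1) → Prop) : ℕ → ∀ n, S n → Prop
  | 0, _, _ => True
  | k + 1, n, s => ∃ t, step n s t ∧ HasChain step k (n + 1) t

theorem HasChain.anti {S : ℕ → Type*} {step : ∀ n, S n → S (n + 1) → Prop} {k j : ℕ} (h : k ≤ j)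
    {n : ℕ} {s : S n} (hs : HasChain step j n s) : HasChain step k n s := by
  induction k generalizing j n with
  | zero => trivial
  | succ k ih =>
    obtain ⟨j, rfl⟩ : ∃ i, j = i + 1 := ⟨j - 1, by omega⟩
    obtain ⟨t, ht, hc⟩ := hs
    exact ⟨t, ht, ih (by omega) hc⟩

/-- König's lemma for a step relation with finite branching between levels indexed by `ℕ`. -/
theorem exists_infinite_chain {S : ℕ → Type*} {step : ∀ n, S n → S (n + 1) → Prop}
    (hfin : ∀ n s, {t | step n s t}.Finite) (s₀ : S 0) (h : ∀ k, HasChain step k 0 s₀) :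
    ∃ u : ∀ n, S n, u 0 = s₀ ∧ ∀ n, step n (u n) (u (n + 1)) := by
  have key : ∀ n (s : {s : S n // ∀ k, HasChain step k n s}),
      ∃ t : {t : S (n + 1) // ∀ k, HasChain step k (n + 1) t}, step n s.1 t.1 := by
    rintro n ⟨s, hs⟩
    by_contra! hcon
    have hbad : ∀ t, step n s t → ∃ k, ¬ HasChain step k (n + 1) t := fun t ht => by
      by_contra! hk
      exact hcon ⟨t, hk⟩ ht
    choose! k hk using hbad
    obtain ⟨K, hK⟩ := ((hfin n s).image k).bddAbove
    obtain ⟨t, ht, hc⟩ := hs (K + 1)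
    exact hk t ht (hc.anti (hK ⟨t, ht, rfl⟩))
  choose next hnext using key
  let u : ∀ n, {s : S n // ∀ k, HasChain step k n s} :=
    fun n => Nat.rec ⟨s₀, h⟩ (fun n s => next n s) n
  exact ⟨fun n => (u n).1, rfl, fun n => hnext n (u n)⟩

variable {A : Type u} [SmallCategory A] {M : Aᵒᵖ ⥤ A ⥤ Type u}

theorem IsEquationalSystem.finite_truncComplex (hM : IsEquationalSystem M) (n : ℕ) (a : A) :
    Finite (TruncComplex M n a) := by
  induction n generalizing a with
  | zero =>
    exact Finite.of_surjective (fun _ : Unit => TruncComplex.nil a)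
      (fun c => by cases c; exact ⟨(), rfl⟩)
  | succ n ih =>
    have := hM.finite_sectors a
    exact Finite.of_surjective
      (fun s : Σ s : (Σ b, Sector M b a), TruncComplex M n s.1 => TruncComplex.cons s.1.2 s.2)
      (fun c => by cases c with | cons m c => exact ⟨⟨⟨_, m⟩, c⟩, rfl⟩)

/-- The truncated complex without its last sector. -/
def TruncComplex.init : {n : ℕ} → {a : A} → TruncComplex M (n + 1) a → TruncComplex M n a
  | 0, a, _ => TruncComplex.nil a
  | _ + 1, _, TruncComplex.cons m c => TruncComplex.cons m c.init

/-- König's lemma for complexes: if a property of truncated complexes at `a` passes to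
truncations and holds for some truncated complex of each length, then it holds for all truncations
of some infinite complex. -/
theorem exists_complex_of_forall_trunc (hM : IsEquationalSystem M) {a : A}
    (P : ∀ n, TruncComplex M n a → Prop) (hP : ∀ n c, P (n + 1) c → P n c.init)
    (h : ∀ n, ∃ c, P n c) :
    ∃ (c : Complex M) (e : c.obj 0 = a), ∀ n, P n (e ▸ c.trunc n) := by
  -- A state is the property that remains to be satisfied after a finite path.
  let T := Σ b : A, {Q : ∀ n, TruncComplex M n b → Prop //
    (∀ n c, Q (n + 1) c → Q n c.init) ∧ ∀ n, ∃ c, Q n c}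
  have key : ∀ s : T, ∃ (t : T) (m : Sector M t.1 s.1),
      t.2.1 = fun n c => s.2.1 (n + 1) (TruncComplex.cons m c) := by
    rintro ⟨b, Q, hQ, hne⟩
    have hanti : ∀ (p : Σ b', Sector M b' b) (n k : ℕ),
        (∃ c, Q (n + k + 1) (TruncComplex.cons p.2 c)) → ∃ c, Q (n + 1) (TruncComplex.cons p.2 c) := by
      intro p n k
      induction k with
      | zero => exact id
      | succ k ih => exact fun ⟨c, hc⟩ => ih ⟨c.init, hQ _ _ hc⟩
    suffices ∃ p : Σ b', Sector M b' b, ∀ n, ∃ c, Q (n + 1) (TruncComplex.cons p.2 c) by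
      obtain ⟨p, hp⟩ := this
      exact ⟨⟨p.1, fun n c => Q (n + 1) (TruncComplex.cons p.2 c), fun n c hc => hQ _ _ hc, hp⟩,
        p.2, rfl⟩
    by_contra! hcon
    choose k hk using hcon
    have := hM.finite_sectors b
    obtain ⟨K, hK⟩ := (Set.finite_range k).bddAbove
    obtain ⟨c, hc⟩ := hne (K + 1)
    cases c with
    | cons m c =>
      obtain ⟨j, rfl⟩ := Nat.exists_eq_add_of_le (hK ⟨⟨_, m⟩, rfl⟩)
      obtain ⟨c', hc'⟩ := hanti ⟨_, m⟩ _ _ ⟨c, hc⟩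
      exact hk _ c' hc'
  choose next sec hsec using key
  have htrunc : ∀ n (u : ℕ → T) (m : ∀ i, Sector M (u (i + 1)).1 (u i).1),
      (∀ i, (u (i + 1)).2.1 = fun n c => (u i).2.1 (n + 1) (TruncComplex.cons (m i) c)) →
      (u 0).2.1 n (Complex.trunc ⟨fun i => (u i).1, m⟩ n) := by
    intro n
    induction n with
    | zero =>
      intro u m _
      obtain ⟨c, hc⟩ := (u 0).2.2.2 0
      cases c
      exact hc
    | succ n ih =>
      intro u m hm
      have := ih (fun i => u (i + 1)) (fun i => m (i + 1)) fun i => hm (i + 1)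
      rw [hm 0] at this
      exact this
  let u : ℕ → T := fun n => Nat.rec ⟨a, P, hP, h⟩ (fun _ s => next s) n
  exact ⟨⟨fun i => (u i).1, fun i => sec (u i)⟩, rfl,
    fun n => htrunc n u (fun i => sec (u i)) fun i => hsec (u i)⟩

end Konig

/-! ### Cells of a coalgebra -/

section Cells

variable {A : Type u} [SmallCategory A] {M : Aᵒᵖ ⥤ A ⥤ Type u}

/-- The set of points of `X a` that can be resolved along a given truncated complex. -/
def truncCell (X : Endofunctor.Coalgebra (moduleTensor M)) :
    {n : ℕ} → {a : A} → TruncComplex M n a → Set (X.V.obj a)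
  | _, _, TruncComplex.nil _ => Set.univ
  | _, _, TruncComplex.cons m c => {x | ∃ t ∈ truncCell X c, Resolves X m x t}

/-- The set of points of `X (c.obj i)` that can be resolved along the part of length `n` of the
complex `c` that starts at `c.obj i`. -/
def levelCell (X : Endofunctor.Coalgebra (moduleTensor M)) (c : Complex M) :
    ℕ → ∀ i, Set (X.V.obj (c.obj i))
  | 0, _ => Set.univ
  | n + 1, i => {x | ∃ t ∈ levelCell X c n (i + 1), Resolves X (c.sec i) x t}

theorem cell_eq_truncCell {J : TopCoalgebra M} (hJ : IsFixedPoint J) {n : ℕ} {a : A}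
    (c : TruncComplex M n a) : cell J hJ c = truncCell J.obj c := by
  induction c with
  | nil a => rfl
  | cons m c ih =>
    ext x
    simp only [cell, truncCell, ih]
    constructor
    · rintro ⟨t, ht, rfl⟩
      exact ⟨t, ht, resolves_sectorMap hJ m t⟩
    · rintro ⟨t, ht, h⟩
      exact ⟨t, ht, (resolves_sectorMap hJ m t).unique hJ h⟩

variable {X : Endofunctor.Coalgebra (moduleTensor M)}

theorem levelCell_tail (c : Complex M) (n i : ℕ) :
    levelCell X c.tail n i = levelCell X c n (i + 1) := by
  induction n generalizing i with
  | zero => rfl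
  | succ n ih =>
    ext x
    simp only [levelCell, ih]
    rfl

theorem truncCell_trunc (c : Complex M) (n : ℕ) :
    truncCell X (c.trunc n) = levelCell X c n 0 := by
  induction n generalizing c with
  | zero => rfl
  | succ n ih =>
    exact congrArg (fun S : Set (X.V.obj (c.obj 1)) => {x | ∃ t ∈ S, Resolves X (c.sec 0) x t})
      ((ih c.tail).trans (levelCell_tail c n 0))

theorem truncCell_subset_init {n : ℕ} {a : A} (c : TruncComplex M (n + 1) a) :
    truncCell X c ⊆ truncCell X c.init := by
  induction n generalizing a with
  | zero => exact fun _ _ => trivial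
  | succ n ih =>
    cases c with
    | cons m c =>
      rintro x ⟨t, ht, h⟩
      exact ⟨t, ih c ht, h⟩

theorem levelCell_succ_subset (c : Complex M) (n i : ℕ) :
    levelCell X c (n + 1) i ⊆ levelCell X c n i := by
  induction n generalizing i with
  | zero => exact fun _ _ => trivial
  | succ n ih =>
    rintro x ⟨t, ht, h⟩
    exact ⟨t, ih _ ht, h⟩

theorem levelCell_antitone (c : Complex M) (i : ℕ) : Antitone fun n => levelCell X c n i :=
  antitone_nat_of_succ_le fun n => levelCell_succ_subset c n i

/-- Every point can be resolved to any finite length. -/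
theorem exists_mem_truncCell (n : ℕ) {a : A} (x : X.V.obj a) :
    ∃ c : TruncComplex M n a, x ∈ truncCell X c := by
  induction n generalizing a with
  | zero => exact ⟨TruncComplex.nil a, trivial⟩
  | succ n ih =>
    obtain ⟨b, m, t, h⟩ := exists_resolves x
    obtain ⟨c, hc⟩ := ih t
    exact ⟨TruncComplex.cons m c, t, hc, h⟩

/-- Coalgebra maps send cells into cells. -/
theorem truncCell_hom {Y : Endofunctor.Coalgebra (moduleTensor M)} (ω : X ⟶ Y) {n : ℕ} {a : A}
    {c : TruncComplex M n a} {x : X.V.obj a} (hx : x ∈ truncCell X c) :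
    ω.f.app a x ∈ truncCell Y c := by
  induction c with
  | nil a => trivial
  | cons m c ih =>
    obtain ⟨t, ht, h⟩ := hx
    exact ⟨_, ih ht, h.hom ω⟩

theorem isClosed_truncCell (hM : IsEquationalSystem M) (hX : TopNondegenerate X.V) {n : ℕ} {a : A}
    (c : TruncComplex M n a) : IsClosed (truncCell X c) := by
  induction c with
  | nil a => exact isClosed_univ
  | @cons n b a m c ih =>
    have := (Tensor.isClosedMap_mk (hM.finite a) hX (b := b) m _ ih).preimage
      (continuous_toTensor X a)
    convert this using 1
    ext x
    exact ⟨fun ⟨t, ht, h⟩ => ⟨t, ht, h.symm⟩, fun ⟨t, ht, h⟩ => ⟨t, ht, h.symm⟩⟩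

/-- A compatible system of points of `X` along a complex: `ξ (t n) = m_{n+1} ⊗ t (n + 1)`. -/
def IsResolution (X : Endofunctor.Coalgebra (moduleTensor M)) (c : Complex M)
    (t : ∀ n, X.V.obj (c.obj n)) : Prop :=
  ∀ n, Resolves X (c.sec n) (t n) (t (n + 1))

theorem IsResolution.mem_levelCell {c : Complex M} {t : ∀ n, X.V.obj (c.obj n)}
    (h : IsResolution X c t) (n i : ℕ) : t i ∈ levelCell X c n i := by
  induction n generalizing i with
  | zero => trivial
  | succ n ih => exact ⟨_, ih _, h i⟩

theorem IsResolution.hom {Y : Endofunctor.Coalgebra (moduleTensor M)} {c : Complex M}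
    {t : ∀ n, X.V.obj (c.obj n)} (h : IsResolution X c t) (ω : X ⟶ Y) :
    IsResolution Y c fun n => ω.f.app _ (t n) :=
  fun n => (h n).hom ω

/-- Every point has an infinite resolution.  The morphism `f` is an identity, but stating the
result with `f` avoids an equation between objects. -/
theorem exists_isResolution {a : A} (x : X.V.obj a) :
    ∃ (c : Complex M) (t : ∀ n, X.V.obj (c.obj n)) (f : c.obj 0 ⟶ a),
      IsResolution X c t ∧ X.V.map f (t 0) = x := by
  have key : ∀ s : (Σ b, X.V.obj b), ∃ (s' : Σ b, X.V.obj b) (m : Sector M s'.1 s.1),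
      Resolves X m s.2 s'.2 := fun s =>
    let ⟨b, m, t, h⟩ := exists_resolves s.2
    ⟨⟨b, t⟩, m, h⟩
  choose next sec hsec using key
  let u : ℕ → Σ b, X.V.obj b := fun n => Nat.rec ⟨a, x⟩ (fun _ s => next s) n
  exact ⟨⟨fun n => (u n).1, fun n => sec (u n)⟩, fun n => (u n).2, 𝟙 a,
    fun n => hsec (u n), by simp [u]⟩

/-- `l.Over f k` says that there is a map of truncated complexes from `l` to `k` whose component
at the right-hand end is `f`. -/
inductive TruncComplex.Over : {n : ℕ} → {a a' : A} → (a ⟶ a') → TruncComplex M n a →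
    TruncComplex M n a' → Prop
  | nil {a a' : A} (f : a ⟶ a') : Over f (TruncComplex.nil a) (TruncComplex.nil a')
  | cons {n : ℕ} {a a' b b' : A} {f : a ⟶ a'} {g : b ⟶ b'} {m : Sector M b a}
      {m' : Sector M b' a'} {l : TruncComplex M n b} {k : TruncComplex M n b'}
      (h : m.push f = m'.pull g) (hlk : Over g l k) :
      Over f (TruncComplex.cons m l) (TruncComplex.cons m' k)

theorem TruncComplex.Over.init {n : ℕ} {a a' : A} {f : a ⟶ a'} {l : TruncComplex M (n + 1) a}
    {k : TruncComplex M (n + 1) a'} (h : l.Over f k) : l.init.Over f k.init := by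
  induction n generalizing a a' with
  | zero => exact TruncComplex.Over.nil f
  | succ n ih =>
    cases h with
    | cons h hlk => exact TruncComplex.Over.cons h (ih hlk)

theorem Complex.init_trunc (c : Complex M) (n : ℕ) : (c.trunc (n + 1)).init = c.trunc n := by
  induction n generalizing c with
  | zero => rfl
  | succ n ih => exact congrArg (TruncComplex.cons (c.sec 0)) (ih c.tail)

theorem TruncComplex.Over.map_mem {n : ℕ} {a a' : A} {f : a ⟶ a'} {l : TruncComplex M n a}
    {k : TruncComplex M n a'} (h : l.Over f k) {x : X.V.obj a} (hx : x ∈ truncCell X l) :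
    X.V.map f x ∈ truncCell X k := by
  induction h with
  | nil f => trivial
  | cons h hlk ih =>
    obtain ⟨t, ht, hr⟩ := hx
    refine ⟨_, ih ht, (resolves_pull _).1 ?_⟩
    rw [← h]
    exact hr.map _

theorem exists_over (hX : TopNondegenerate X.V) {n : ℕ} {a a' : A} {f : a ⟶ a'}
    {k : TruncComplex M n a'} {x : X.V.obj a} (hx : X.V.map f x ∈ truncCell X k) :
    ∃ l : TruncComplex M n a, l.Over f k ∧ x ∈ truncCell X l := by
  induction k generalizing a with
  | nil a' => exact ⟨_, TruncComplex.Over.nil f, trivial⟩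
  | cons m k ih =>
    obtain ⟨t, ht, hr⟩ := hx
    obtain ⟨d, l, g, w, hl, rfl, hg⟩ := hr.lift hX
    obtain ⟨l', hl', hw⟩ := ih ht
    exact ⟨TruncComplex.cons l l', TruncComplex.Over.cons hg hl', w, hw, hl⟩

/-- The cells containing a point are directed by refinement, in every coalgebra at once. -/
theorem exists_truncCell_subset_inter (hX : TopNondegenerate X.V)
    (Y : Endofunctor.Coalgebra (moduleTensor M)) {n n' : ℕ} {a a₁ a₂ : A} {f : a ⟶ a₁}
    {f' : a ⟶ a₂} {k : TruncComplex M n a₁} {k' : TruncComplex M n' a₂} {x : X.V.obj a}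
    (hx : X.V.map f x ∈ truncCell X k) (hx' : X.V.map f' x ∈ truncCell X k') :
    ∃ (i : ℕ) (l : TruncComplex M i a), x ∈ truncCell X l ∧ ∀ y ∈ truncCell Y l,
      Y.V.map f y ∈ truncCell Y k ∧ Y.V.map f' y ∈ truncCell Y k' := by
  induction k generalizing a a₂ n' with
  | nil a₁ =>
    obtain ⟨l, hl, hxl⟩ := exists_over hX hx'
    exact ⟨_, l, hxl, fun y hy => ⟨trivial, hl.map_mem hy⟩⟩
  | cons m k ih =>
    cases k' with
    | nil a₂ =>
      obtain ⟨l, hl, hxl⟩ := exists_over hX hx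
      exact ⟨_, l, hxl, fun y hy => ⟨hl.map_mem hy, trivial⟩⟩
    | cons m' k' =>
      obtain ⟨t, ht, hr⟩ := hx
      obtain ⟨t', ht', hr'⟩ := hx'
      obtain ⟨d, l, g, g', w, hl, rfl, rfl, hg, hg'⟩ := hr.lift₂ hX hr'
      obtain ⟨i, l', hw, hl'⟩ := ih ht ht'
      refine ⟨i + 1, TruncComplex.cons l l', ⟨w, hw, hl⟩, ?_⟩
      rintro y ⟨s, hs, hys⟩
      refine ⟨⟨_, (hl' s hs).1, (resolves_pull _).1 ?_⟩, ⟨_, (hl' s hs).2, (resolves_pull _).1 ?_⟩⟩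
      · rw [← hg]; exact hys.map f
      · rw [← hg']; exact hys.map f'

end Cells

/-! ### Terminality from small cells -/

section Terminal

variable {A : Type u} [SmallCategory A] {M : Aᵒᵖ ⥤ A ⥤ Type u}

/-- `Shadows X Y x p` says that `p` lies in every cell of `Y` whose counterpart in `X`
contains `x`. -/
def Shadows (X Y : Endofunctor.Coalgebra (moduleTensor M)) {a : A} (x : X.V.obj a)
    (p : Y.V.obj a) : Prop :=
  ∀ (n : ℕ) (c : TruncComplex M n a), x ∈ truncCell X c → p ∈ truncCell Y c

/-- Along an infinite complex, the intersection of the cells has at most one point. -/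
def HasThinCells (X : Endofunctor.Coalgebra (moduleTensor M)) : Prop :=
  ∀ c : Complex M, (⋂ n : ℕ, truncCell X (c.trunc n)).Subsingleton

variable {J : TopCoalgebra M} {X : Endofunctor.Coalgebra (moduleTensor M)}

theorem Shadows.unique (hM : IsEquationalSystem M) (hthin : HasThinCells J.obj) {a : A}
    {x : X.V.obj a} {p q : J.obj.V.obj a} (hp : Shadows X J.obj x p) (hq : Shadows X J.obj x q) :
    p = q := by
  obtain ⟨c, rfl, hc⟩ := exists_complex_of_forall_trunc hM (fun n c => x ∈ truncCell X c)
    (fun n c hx => truncCell_subset_init c hx) (fun n => exists_mem_truncCell n x)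
  exact hthin c (Set.mem_iInter.2 fun n => hp n _ (hc n)) (Set.mem_iInter.2 fun n => hq n _ (hc n))

theorem nonempty_truncCell (hM : IsEquationalSystem M) (hJ : IsFixedPoint J) (hocc : Occupied J)
    {n : ℕ} {a : A} {c : TruncComplex M n a} {x : X.V.obj a} (hx : x ∈ truncCell X c) :
    (truncCell J.obj c).Nonempty := by
  induction c with
  | nil a =>
    obtain ⟨c, hc, -⟩ := exists_complex_of_forall_trunc hM (fun n c => x ∈ truncCell X c)
      (fun n c hx => truncCell_subset_init c hx) (fun n => exists_mem_truncCell n x)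
    obtain ⟨p⟩ := hocc a ⟨c, hc⟩
    exact ⟨p, trivial⟩
  | cons m c ih =>
    obtain ⟨t, ht, -⟩ := hx
    obtain ⟨s, hs⟩ := ih ht
    exact ⟨sectorMap J hJ m s, s, hs, resolves_sectorMap hJ m s⟩

/-- By compactness, every point of a coalgebra is shadowed by a point of `J`. -/
theorem exists_shadows (hM : IsEquationalSystem M) (hJ : IsFixedPoint J) (hocc : Occupied J)
    (hcomp : ∀ a, CompactSpace (J.obj.V.obj a)) (hX : TopNondegenerate X.V) {a : A}
    (x : X.V.obj a) : ∃ p, Shadows X J.obj x p := by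
  have := hcomp a
  let I := Σ n, {c : TruncComplex M n a // x ∈ truncCell X c}
  have : Nonempty I := ⟨⟨0, TruncComplex.nil a, trivial⟩⟩
  obtain ⟨p, hp⟩ := IsCompact.nonempty_iInter_of_directed_nonempty_isCompact_isClosed
    (fun i : I => truncCell J.obj i.2.1)
    (fun i j => by
      obtain ⟨n, l, hx, hl⟩ := exists_truncCell_subset_inter (f := 𝟙 a) (f' := 𝟙 a) (x := x) hX J.obj
        (k := i.2.1) (k' := j.2.1) (by simpa using i.2.2) (by simpa using j.2.2)
      refine ⟨⟨n, l, hx⟩, fun y hy => ?_, fun y hy => ?_⟩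
      · simpa using (hl y hy).1
      · simpa using (hl y hy).2)
    (fun i => nonempty_truncCell hM hJ hocc i.2.2)
    (fun i => (isClosed_truncCell hM J.property _).isCompact)
    (fun i => isClosed_truncCell hM J.property _)
  exact ⟨p, fun n c hc => Set.mem_iInter.1 hp ⟨n, c, hc⟩⟩

theorem Shadows.map (hX : TopNondegenerate X.V) {Y : Endofunctor.Coalgebra (moduleTensor M)}
    {a a' : A} {x : X.V.obj a} {p : Y.V.obj a} (h : Shadows X Y x p) (f : a ⟶ a') :
    Shadows X Y (X.V.map f x) (Y.V.map f p) := by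
  intro n c hc
  obtain ⟨l, hl, hx⟩ := exists_over hX hc
  exact hl.map_mem (h n l hx)

theorem Shadows.of_resolves (hX : TopNondegenerate X.V)
    {Y : Endofunctor.Coalgebra (moduleTensor M)} {b a : A} {m : Sector M b a} {x : X.V.obj a}
    {t : X.V.obj b} {p : Y.V.obj a} {s : Y.V.obj b}
    (hx : Resolves X m x t) (hp : Resolves Y m p s) (h : ∀ (d : A) (g : d ⟶ b) (z : X.V.obj d),
      X.V.map g z = t → ∃ w : Y.V.obj d, Y.V.map g w = s ∧ Shadows X Y z w) :
    Shadows X Y x p := by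
  intro n c hc
  cases c with
  | nil => trivial
  | cons m' c =>
    obtain ⟨t', ht', hr⟩ := hc
    obtain ⟨d, g, g', z, hg, hz, rfl⟩ := hx.exists_span hX hr
    obtain ⟨w, rfl, hw⟩ := h d g z hz
    refine ⟨Y.V.map g' w, hw.map hX g' _ c ht', ?_⟩
    rw [← resolves_pull, ← hg, resolves_pull]
    exact hp

/-- The preimage of a closed set `C` under a map to which the points are related by `Shadows` is
`⋂ n, ⋃ c, truncCell X c`, where `c` runs over the truncated complexes of length `n` whose cell
in `J` meets `C`. -/
theorem continuous_of_shadows (hM : IsEquationalSystem M)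
    (hcomp : ∀ a, CompactSpace (J.obj.V.obj a)) (hthin : HasThinCells J.obj)
    (hX : TopNondegenerate X.V) {a : A} {ω : X.V.obj a → J.obj.V.obj a}
    (hω : ∀ x, Shadows X J.obj x (ω x)) : Continuous ω := by
  refine continuous_iff_isClosed.2 fun C hC => ?_
  have : ω ⁻¹' C = ⋂ n : ℕ, ⋃ c : {c : TruncComplex M n a // (truncCell J.obj c ∩ C).Nonempty},
      truncCell X c.1 := by
    ext x
    simp only [Set.mem_preimage, Set.mem_iInter, Set.mem_iUnion]
    constructor
    · intro hx n
      obtain ⟨c, hc⟩ := exists_mem_truncCell n x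
      exact ⟨⟨c, ω x, hω x n c hc, hx⟩, hc⟩
    · intro h
      obtain ⟨c, rfl, hc⟩ := exists_complex_of_forall_trunc hM
        (fun n c => (truncCell J.obj c ∩ C).Nonempty ∧ x ∈ truncCell X c)
        (fun n c hx => ⟨hx.1.mono (Set.inter_subset_inter_left _ (truncCell_subset_init c)),
          truncCell_subset_init c hx.2⟩)
        (fun n => let ⟨c, hc⟩ := h n; ⟨c.1, c.2, hc⟩)
      have := hcomp (c.obj 0)
      obtain ⟨p, hp⟩ := IsCompact.nonempty_iInter_of_sequence_nonempty_isCompact_isClosed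
        (fun n => truncCell J.obj (c.trunc n) ∩ C)
        (fun n => Set.inter_subset_inter_left _ (by
          rw [← c.init_trunc n]
          exact truncCell_subset_init _))
        (fun n => (hc n).1)
        ((isClosed_truncCell hM J.property _).inter hC).isCompact
        (fun n => (isClosed_truncCell hM J.property _).inter hC)
      rw [Set.mem_iInter] at hp
      have : ω x = p := hthin c (Set.mem_iInter.2 fun n => hω x n _ (hc n).2)
        (Set.mem_iInter.2 fun n => (hp n).1)
      exact this ▸ (hp 0).2
  rw [this]
  refine isClosed_iInter fun n => ?_
  have := hM.finite_truncComplex n a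
  exact isClosed_iUnion_of_finite fun c => isClosed_truncCell hM hX c.1

/-- An occupied fixed point with compact values and thin cells is terminal: the map sends a point
to the only point that shadows it. -/
theorem isUniversalSolution_of_hasThinCells (hM : IsEquationalSystem M) (hJ : IsFixedPoint J)
    (hocc : Occupied J) (hcomp : ∀ a, CompactSpace (J.obj.V.obj a))
    (hthin : HasThinCells J.obj) : IsUniversalSolution J := by
  have hex : ∀ (X : TopCoalgebra M) (a : A) (x : X.obj.V.obj a), ∃ p, Shadows X.obj J.obj x p :=
    fun X a x => exists_shadows hM hJ hocc hcomp X.property x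
  choose ω hω using hex
  let T (X : TopCoalgebra M) : X.obj.V ⟶ J.obj.V :=
    { app := fun a => TopCat.ofHom
        ⟨ω X a, continuous_of_shadows hM hcomp hthin X.property (hω X a)⟩
      naturality := fun a a' f => by
        ext x
        exact (hω X a' _).unique hM hthin ((hω X a x).map X.property f) }
  refine ⟨IsTerminal.ofUniqueHom (fun X => coalgebraHomMk (T X) fun a x => ?_) fun X f => ?_⟩
  · obtain ⟨b, m, t, h⟩ := exists_resolves x
    refine ⟨b, m, t, h, ?_⟩
    have hs := resolves_sectorMap hJ m (ω X b t)
    have : ω X a x = sectorMap J hJ m (ω X b t) := by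
      refine (hω X a x).unique hM hthin (Shadows.of_resolves X.property h hs ?_)
      rintro d g z rfl
      exact ⟨ω X d z, ((hω X b _).unique hM hthin ((hω X d z).map X.property g)).symm, hω X d z⟩
    change Resolves J.obj m (ω X a x) (ω X b t)
    rw [this]
    exact hs
  · refine ObjectProperty.hom_ext _ (Endofunctor.Coalgebra.ext (NatTrans.ext (funext fun a => ?_)))
    ext x
    exact Shadows.unique hM hthin (fun n c hc => truncCell_hom f.hom hc) (hω X a x)

end Terminal

/-! ### Metrizability from small cells -/

section Metric

variable {A : Type u} [SmallCategory A] {M : Aᵒᵖ ⥤ A ⥤ Type u} {J : TopCoalgebra M}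

/-- The complement of the union of a set of cells given by truncated complexes of length `n`. -/
def cellCompl (X : Endofunctor.Coalgebra (moduleTensor M)) (a : A) (n : ℕ)
    (S : Set (TruncComplex M n a)) : Set (X.V.obj a) :=
  (⋃ c : S, truncCell X c.1)ᶜ

theorem isOpen_cellCompl (hM : IsEquationalSystem M) (a : A) (n : ℕ)
    (S : Set (TruncComplex M n a)) : IsOpen (cellCompl J.obj a n S) := by
  have := hM.finite_truncComplex n a
  exact (isClosed_iUnion_of_finite fun c : S => isClosed_truncCell hM J.property c.1).isOpen_compl

/-- Each open neighbourhood of `p` contains, for some `n`, every cell of level `n` that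
contains `p`. -/
theorem exists_star_subset (hM : IsEquationalSystem M)
    (hcomp : ∀ a, CompactSpace (J.obj.V.obj a)) (hthin : HasThinCells J.obj) {a : A}
    {p : J.obj.V.obj a} {O : Set (J.obj.V.obj a)} (hO : IsOpen O) (hp : p ∈ O) :
    ∃ n, ∀ c : TruncComplex M n a, p ∈ truncCell J.obj c → truncCell J.obj c ⊆ O := by
  by_contra! hcon
  obtain ⟨c, rfl, hc⟩ := exists_complex_of_forall_trunc hM
    (fun n c => p ∈ truncCell J.obj c ∧ (truncCell J.obj c ∩ Oᶜ).Nonempty)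
    (fun n c hx => ⟨truncCell_subset_init c hx.1,
      hx.2.mono (Set.inter_subset_inter_left _ (truncCell_subset_init c))⟩)
    (fun n => let ⟨c, hc⟩ := hcon n; ⟨c, hc.1, Set.not_subset.1 hc.2⟩)
  have := hcomp (c.obj 0)
  obtain ⟨q, hq⟩ := IsCompact.nonempty_iInter_of_sequence_nonempty_isCompact_isClosed
    (fun n => truncCell J.obj (c.trunc n) ∩ Oᶜ)
    (fun n => Set.inter_subset_inter_left _ (by
      rw [← c.init_trunc n]
      exact truncCell_subset_init _))
    (fun n => (hc n).2)
    ((isClosed_truncCell hM J.property _).inter hO.isClosed_compl).isCompact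
    (fun n => (isClosed_truncCell hM J.property _).inter hO.isClosed_compl)
  rw [Set.mem_iInter] at hq
  have : p = q := hthin c (Set.mem_iInter.2 fun n => (hc n).1) (Set.mem_iInter.2 fun n => (hq n).1)
  exact (hq 0).2 (this ▸ hp)

/-- The complement of the cells of level `n` that miss `p` is contained in the union of those
that contain `p`, since the cells of level `n` cover `J a`. -/
theorem cellCompl_subset_star (X : Endofunctor.Coalgebra (moduleTensor M)) {a : A}
    (p : X.V.obj a) (n : ℕ) : cellCompl X a n {c | p ∉ truncCell X c} ⊆
      ⋃ c : {c : TruncComplex M n a // p ∈ truncCell X c}, truncCell X c.1 := by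
  intro q hq
  obtain ⟨c, hc⟩ := exists_mem_truncCell n q
  by_contra hcon
  refine hq (Set.mem_iUnion.2 ⟨⟨c, fun hp => hcon (Set.mem_iUnion.2 ⟨⟨c, hp⟩, hc⟩)⟩, hc⟩)

theorem mem_cellCompl_self (X : Endofunctor.Coalgebra (moduleTensor M)) {a : A}
    (p : X.V.obj a) (n : ℕ) : p ∈ cellCompl X a n {c | p ∉ truncCell X c} := by
  intro h
  obtain ⟨c, hc⟩ := Set.mem_iUnion.1 h
  exact c.2 hc

theorem metrizableSpace_of_hasThinCells (hM : IsEquationalSystem M)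
    (hcomp : ∀ a, CompactSpace (J.obj.V.obj a)) (hthin : HasThinCells J.obj) (a : A) :
    MetrizableSpace (J.obj.V.obj a) := by
  have := hcomp a
  have hT1 : T1Space (J.obj.V.obj a) := by
    refine ⟨fun p => ?_⟩
    -- A point is the intersection of the cells along a complex on which it lies.
    obtain ⟨c, rfl, hc⟩ := exists_complex_of_forall_trunc hM
      (fun n c => p ∈ truncCell J.obj c)
      (fun n c hx => truncCell_subset_init c hx) (fun n => exists_mem_truncCell n p)
    have : {p} = ⋂ n, truncCell J.obj (c.trunc n) :=
      ((hthin c).eq_singleton_of_mem (Set.mem_iInter.2 hc)).symm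
    rw [this]
    exact isClosed_iInter fun n => isClosed_truncCell hM J.property _
  have hreg : RegularSpace (J.obj.V.obj a) := by
    refine RegularSpace.of_exists_mem_nhds_isClosed_subset fun p s hs => ?_
    obtain ⟨O, hOs, hO, hp⟩ := mem_nhds_iff.1 hs
    obtain ⟨n, hn⟩ := exists_star_subset hM hcomp hthin hO hp
    have := hM.finite_truncComplex n a
    refine ⟨⋃ c : {c : TruncComplex M n a // p ∈ truncCell J.obj c}, truncCell J.obj c.1,
      Filter.mem_of_superset ((isOpen_cellCompl hM a n _).mem_nhds (mem_cellCompl_self J.obj p n))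
        (cellCompl_subset_star J.obj p n),
      isClosed_iUnion_of_finite fun c => isClosed_truncCell hM J.property _,
      Set.Subset.trans (Set.iUnion_subset fun c => hn c.1 c.2) hOs⟩
  have hbasis : IsTopologicalBasis (Set.range fun s : Σ n, Set (TruncComplex M n a) =>
      cellCompl J.obj a s.1 s.2) := by
    refine isTopologicalBasis_of_isOpen_of_nhds ?_ fun p O hp hO => ?_
    · rintro _ ⟨s, rfl⟩
      exact isOpen_cellCompl hM a _ _
    · obtain ⟨n, hn⟩ := exists_star_subset hM hcomp hthin hO hp
      have hsub : cellCompl J.obj a n {c | p ∉ truncCell J.obj c} ⊆ O :=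
        (cellCompl_subset_star J.obj p n).trans (Set.iUnion_subset fun c => hn c.1 c.2)
      exact ⟨_, ⟨⟨n, _⟩, rfl⟩, mem_cellCompl_self J.obj p n, hsub⟩
  have := fun n => hM.finite_truncComplex n a
  have : SecondCountableTopology (J.obj.V.obj a) :=
    hbasis.secondCountableTopology (Set.countable_range _)
  infer_instance

theorem hasShrinkingMetric_of_hasThinCells (hM : IsEquationalSystem M) (hJ : IsFixedPoint J)
    (hcomp : ∀ a, CompactSpace (J.obj.V.obj a)) (hthin : HasThinCells J.obj) (a : A) :
    HasShrinkingMetric J hJ a := by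
  have := metrizableSpace_of_hasThinCells hM hcomp hthin a
  let d : MetricSpace (J.obj.V.obj a) := metrizableSpaceMetric (J.obj.V.obj a)
  refine ⟨d, rfl, ?_⟩
  simp only [cell_eq_truncCell]
  by_contra hne
  obtain ⟨ε, hε, hlt⟩ := exists_between (pos_iff_ne_zero.2 hne)
  obtain ⟨c, rfl, hc⟩ := exists_complex_of_forall_trunc hM
    (fun n c => ε < Metric.ediam (truncCell J.obj c))
    (fun n c hx => hx.trans_le (Metric.ediam_mono (truncCell_subset_init c)))
    (fun n => lt_iSup_iff.1 (hlt.trans_le (iInf_le _ n)))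
  have := hcomp (c.obj 0)
  -- Pairs of points of the `n`th cell at distance at least `ε` form a decreasing sequence of
  -- nonempty compact sets.
  let K (n : ℕ) : Set (J.obj.V.obj (c.obj 0) × J.obj.V.obj (c.obj 0)) :=
    (truncCell J.obj (c.trunc n) ×ˢ truncCell J.obj (c.trunc n)) ∩ {q | ε ≤ edist q.1 q.2}
  have hK : ∀ n, IsClosed (K n) := fun n =>
    ((isClosed_truncCell hM J.property _).prod (isClosed_truncCell hM J.property _)).inter
      (isClosed_le continuous_const (continuous_fst.edist continuous_snd))
  obtain ⟨q, hq⟩ := IsCompact.nonempty_iInter_of_sequence_nonempty_isCompact_isClosed K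
    (fun n => Set.inter_subset_inter_left _ (by
      have : truncCell J.obj (c.trunc (n + 1)) ⊆ truncCell J.obj (c.trunc n) := by
        rw [← c.init_trunc n]
        exact truncCell_subset_init _
      exact Set.prod_mono this this))
    (fun n => by
      by_contra hcon
      refine (hc n).not_ge (Metric.ediam_le fun x hx y hy => ?_)
      by_contra hlt
      exact hcon ⟨(x, y), ⟨hx, hy⟩, (not_le.1 hlt).le⟩)
    (hK 0).isCompact hK
  rw [Set.mem_iInter] at hq
  have : q.1 = q.2 := hthin c (Set.mem_iInter.2 fun n => (hq n).1.1)
    (Set.mem_iInter.2 fun n => (hq n).1.2)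
  have h₀ : ε ≤ edist q.1 q.2 := (hq 0).2
  rw [this, edist_self] at h₀
  exact hε.not_ge h₀

theorem hasThinCells_of_hasShrinkingMetric (hJ : IsFixedPoint J)
    (h : ∀ a, HasShrinkingMetric J hJ a) : HasThinCells J.obj := by
  intro c x hx y hy
  obtain ⟨d, -, hd⟩ := h (c.obj 0)
  rw [Set.mem_iInter] at hx hy
  refine edist_le_zero.1 (le_of_le_of_eq (le_iInf fun n => ?_) hd)
  refine le_trans ?_ (le_iSup _ (c.trunc n))
  rw [cell_eq_truncCell]
  exact Metric.edist_le_ediam_of_mem (hx n) (hy n)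

end Metric

/-! ### Discrete coalgebras that represent resolutions along a complex -/

section Path

variable {A : Type u} [SmallCategory A] {M : Aᵒᵖ ⥤ A ⥤ Type u}

/-- The discrete space `∑ n, A(d n, a)`. -/
def PathSpace (d : ℕ → A) (a : A) : Type u := Σ n, (d n ⟶ a)

instance (d : ℕ → A) (a : A) : TopologicalSpace (PathSpace d a) := ⊥

instance (d : ℕ → A) (a : A) : DiscreteTopology (PathSpace d a) := ⟨rfl⟩

/-- The functor `a ↦ ∑ n, A(d n, a)`, with discrete values. -/
@[simps]
def pathFunctor (d : ℕ → A) : A ⥤ TopCat.{u} where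
  obj a := TopCat.of (PathSpace d a)
  map f := TopCat.ofHom ⟨fun s => ⟨s.1, s.2 ≫ f⟩, continuous_of_discreteTopology⟩
  map_id a := by
    ext s
    exact Sigma.ext rfl (heq_of_eq (Category.comp_id s.2))
  map_comp f g := by
    ext s
    exact Sigma.ext rfl (heq_of_eq (Category.assoc s.2 f g).symm)

/-- The discrete coalgebra `a ↦ ∑ n, A(c n, a)` of a complex `c`, with structure map
`f ↦ f m_{n+1} ⊗ 1` for `f : c n ⟶ a`.  Maps out of it are resolutions along `c`. -/
def pathCoalgebra (c : Complex M) : TopCoalgebra M where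
  obj :=
    { V := pathFunctor c.obj
      str :=
        { app := fun a => TopCat.ofHom
            { toFun := fun s : PathSpace c.obj a => (Tensor.mk (Y := M.flip.obj a)
                (X := pathFunctor c.obj ⋙ forget TopCat)
                (Sector.push s.2 (c.sec s.1))
                (⟨s.1 + 1, 𝟙 _⟩ : PathSpace c.obj (c.obj (s.1 + 1))) :
                  Tensor (M.flip.obj a) (pathFunctor c.obj ⋙ forget TopCat))
              continuous_toFun := continuous_of_discreteTopology }
          naturality := fun a a' f => by
            ext s
            exact congrArg (fun m => Tensor.mk (Y := M.flip.obj a')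
              (X := pathFunctor c.obj ⋙ forget TopCat) m
                (⟨s.1 + 1, 𝟙 _⟩ : PathSpace c.obj (c.obj (s.1 + 1))))
              (Sector.push_comp s.2 f (c.sec s.1)) } }
  property := by
    refine ⟨(setNondegenerate_sumCorepresentable c.obj).of_iso
      (NatIso.ofComponents (fun a => Iso.refl _) fun f => rfl), fun a b f C _ => ?_⟩
    exact isClosed_discrete (α := PathSpace c.obj b) _

/-- The tautological resolution along `c` in its coalgebra. -/
theorem isResolution_pathCoalgebra (c : Complex M) :
    IsResolution (pathCoalgebra c).obj c fun n => (⟨n, 𝟙 _⟩ : PathSpace c.obj (c.obj n)) :=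
  fun n => congrArg (fun m => Tensor.mk (Y := M.flip.obj (c.obj n))
    (X := pathFunctor c.obj ⋙ forget TopCat) m
      (⟨n + 1, 𝟙 _⟩ : PathSpace c.obj (c.obj (n + 1)))) (Sector.push_id (c.sec n))

/-- The coalgebra map `f ↦ f (t n)` that corresponds to a resolution `t` along `c`. -/
def pathCoalgebraHom {X : TopCoalgebra M} {c : Complex M} {t : ∀ n, X.obj.V.obj (c.obj n)}
    (h : IsResolution X.obj c t) : pathCoalgebra c ⟶ X :=
  coalgebraHomMk (X := pathCoalgebra c)
    { app := fun a => TopCat.ofHom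
        { toFun := fun s : PathSpace c.obj a => X.obj.V.map s.2 (t s.1)
          continuous_toFun := continuous_of_discreteTopology }
      naturality := fun a a' f => by
        ext s
        exact congrArg (fun k => k (t s.1)) (X.obj.V.map_comp s.2 f) }
    (fun a (s : PathSpace c.obj a) => ⟨c.obj (s.1 + 1), Sector.push s.2 (c.sec s.1),
      (⟨s.1 + 1, 𝟙 _⟩ : PathSpace c.obj (c.obj (s.1 + 1))), rfl, by
        have := (h s.1).map s.2
        change Resolves X.obj _ (X.obj.V.map s.2 (t s.1)) (X.obj.V.map (𝟙 _) (t (s.1 + 1)))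
        simpa using this⟩)

variable {J : TopCoalgebra M}

theorem IsUniversalSolution.exists_isResolution (hT : IsUniversalSolution J) (c : Complex M) :
    ∃ t, IsResolution J.obj c t :=
  ⟨_, (isResolution_pathCoalgebra c).hom (hT.some.from (pathCoalgebra c)).hom⟩

theorem IsUniversalSolution.isResolution_unique (hT : IsUniversalSolution J) {c : Complex M}
    {t t' : ∀ n, J.obj.V.obj (c.obj n)} (h : IsResolution J.obj c t)
    (h' : IsResolution J.obj c t') (n : ℕ) : t n = t' n := by
  have e := congrArg (fun k => k.hom.f.app (c.obj n)
    (⟨n, 𝟙 _⟩ : PathSpace c.obj (c.obj n)))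
    (hT.some.hom_ext (pathCoalgebraHom h) (pathCoalgebraHom h'))
  have e' : J.obj.V.map (𝟙 _) (t n) = J.obj.V.map (𝟙 _) (t' n) := e
  simpa using e'

theorem IsUniversalSolution.occupied (hT : IsUniversalSolution J) : Occupied J := by
  rintro _ ⟨c, rfl⟩
  obtain ⟨t, -⟩ := hT.exists_isResolution c
  exact ⟨t 0⟩

/-- Let `p` lie in all cells along `c`, and choose any resolution of `p`, along `k` say.  By
König's lemma some complex maps both to `c` and to `k`, and uniqueness of resolutions along these
three complexes shows that `p` is the starting point of the resolution along `c`. -/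
theorem IsUniversalSolution.eq_of_mem_levelCell (hM : IsEquationalSystem M)
    (hT : IsUniversalSolution J) {c : Complex M} {t : ∀ n, J.obj.V.obj (c.obj n)}
    (h : IsResolution J.obj c t) {p : J.obj.V.obj (c.obj 0)}
    (hp : ∀ n, p ∈ levelCell J.obj c n 0) : p = t 0 := by
  obtain ⟨k, s, f, hs, rfl⟩ := SelfSim.exists_isResolution p
  let S (n : ℕ) := Σ d : A, (d ⟶ c.obj n) × (d ⟶ k.obj n)
  let step (n : ℕ) (u : S n) (v : S (n + 1)) : Prop := ∃ l : Sector M v.1 u.1,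
    l.push u.2.1 = Sector.pull v.2.1 (c.sec n) ∧ l.push u.2.2 = Sector.pull v.2.2 (k.sec n)
  have hfin : ∀ n u, {v | step n u v}.Finite := by
    intro n u
    have := hM.finite_sectors u.1
    refine (Set.finite_iUnion fun r : Σ d, Sector M d u.1 =>
      ((hM.finite_pull (c.sec n) (r.2.push u.2.1)).prod
        (hM.finite_pull (k.sec n) (r.2.push u.2.2))).image
          (fun g => (⟨r.1, g⟩ : S (n + 1)))).subset ?_
    rintro ⟨d, g⟩ ⟨l, h₁, h₂⟩
    exact Set.mem_iUnion.2 ⟨⟨d, l⟩, g, ⟨h₁.symm, h₂.symm⟩, rfl⟩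
  have hchain : ∀ j n (u : S n) (z : J.obj.V.obj u.1),
      J.obj.V.map u.2.1 z ∈ levelCell J.obj c j n → J.obj.V.map u.2.2 z = s n →
      HasChain step j n u := by
    intro j
    induction j with
    | zero => intros; trivial
    | succ j ih =>
      rintro n u z ⟨w, hw, hr⟩ hz
      obtain ⟨d, l, g, g', v, -, rfl, hv, h₁, h₂⟩ :=
        hr.lift₂ J.property (m' := k.sec n) (t' := s (n + 1)) (g' := u.2.2) (by rw [hz]; exact hs n)
      exact ⟨⟨d, g, g'⟩, ⟨l, h₁, h₂⟩, ih _ _ v hw hv⟩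
  obtain ⟨u, hu₀, hu⟩ := exists_infinite_chain hfin ⟨k.obj 0, f, 𝟙 _⟩
    (fun j => hchain j 0 _ (s 0) (hp j) (by simp))
  choose l hc hk using hu
  obtain ⟨v, hv⟩ := hT.exists_isResolution ⟨fun n => (u n).1, l⟩
  have e₁ := hT.isResolution_unique (t := fun n => J.obj.V.map (u n).2.1 (v n)) (fun n => by
    rw [← resolves_pull, ← hc n]
    exact (hv n).map _) h 0
  have e₂ := hT.isResolution_unique (t := fun n => J.obj.V.map (u n).2.2 (v n)) (fun n => by
    rw [← resolves_pull, ← hk n]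
    exact (hv n).map _) hs 0
  have key : ∀ (w : S 0) (y : J.obj.V.obj w.1), w = ⟨k.obj 0, f, 𝟙 _⟩ →
      J.obj.V.map w.2.2 y = s 0 → J.obj.V.map f (s 0) = J.obj.V.map w.2.1 y := by
    rintro _ y rfl hy
    rw [← hy]
    simp
  exact (key _ _ hu₀ e₂).trans e₁

theorem IsUniversalSolution.hasThinCells (hM : IsEquationalSystem M)
    (hT : IsUniversalSolution J) : HasThinCells J.obj := by
  intro c x hx y hy
  obtain ⟨t, ht⟩ := hT.exists_isResolution c
  simp only [truncCell_trunc, Set.mem_iInter] at hx hy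
  exact (hT.eq_of_mem_levelCell hM ht hx).trans (hT.eq_of_mem_levelCell hM ht hy).symm

end Path

/-! ### Compactness of a universal solution -/

section Compact

variable {A : Type u} [SmallCategory A] {M : Aᵒᵖ ⥤ A ⥤ Type u}

/-- The complex obtained from `c` by replacing `m₁` by `g m₁`, for a map `g` out of `c.obj 0`. -/
def Complex.push (c : Complex M) {a : A} (g : c.obj 0 ⟶ a) : Complex M where
  obj
    | 0 => a
    | n + 1 => c.obj (n + 1)
  sec
    | 0 => Sector.push g (c.sec 0)
    | n + 1 => c.sec (n + 1)

theorem mem_levelCell_push {X : Endofunctor.Coalgebra (moduleTensor M)} {c : Complex M} {a : A}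
    (g : c.obj 0 ⟶ a) {n : ℕ} {p : X.V.obj (c.obj 0)} (hp : p ∈ levelCell X c n 0) :
    X.V.map g p ∈ levelCell X (c.push g) n 0 := by
  cases n with
  | zero => trivial
  | succ n =>
    obtain ⟨t, ht, h⟩ := hp
    refine ⟨t, ?_, h.map g⟩
    rw [← levelCell_tail] at ht ⊢
    exact ht

/-- The set `X a`, to be given a topology determined by the cells and by a choice of a point `q c`
for each complex `c`. -/
def CellSpace (X : Endofunctor.Coalgebra (moduleTensor M))
    (_q : ∀ c : Complex M, X.V.obj (c.obj 0)) (a : A) : Type u :=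
  X.V.obj a

/-- A set is closed if it contains the point `f (q c)` whenever it meets the image under `f` of
every cell along `c`.  If `q c` is the only point in all cells along `c`, for every `c`, this is the
quotient topology on `X a` of the profinite space of complexes ending at `a`.  Testing against
complexes ending at `c.obj 0` and a morphism `f` avoids equations between objects. -/
instance (X : Endofunctor.Coalgebra (moduleTensor M))
    (q : ∀ c : Complex M, X.V.obj (c.obj 0)) (a : A) : TopologicalSpace (CellSpace X q a) :=
  TopologicalSpace.ofClosed
    {C | ∀ (c : Complex M) (f : c.obj 0 ⟶ a),
      (∀ n, ∃ p ∈ levelCell X c n 0, X.V.map f p ∈ C) → X.V.map f (q c) ∈ C}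
    (fun c f h => let ⟨_, _, hp⟩ := h 0; hp)
    (fun F hF c f h => by
      refine Set.mem_sInter.2 fun C hC => hF hC c f fun n => ?_
      obtain ⟨p, hp, hpF⟩ := h n
      exact ⟨p, hp, Set.mem_sInter.1 hpF C hC⟩)
    (fun C hC D hD c f h => by
      by_cases hn : ∀ n, ∃ p ∈ levelCell X c n 0, X.V.map f p ∈ C
      · exact Or.inl (hC c f hn)
      · refine Or.inr (hD c f fun n => ?_)
        push Not at hn
        obtain ⟨k, hk⟩ := hn
        -- From level `k` on, the points found in `C ∪ D` have to lie in `D`.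
        obtain ⟨p, hp, hpCD⟩ := h (max n k)
        exact ⟨p, levelCell_antitone c 0 (le_max_left n k) hp,
          hpCD.resolve_left (hk p (levelCell_antitone c 0 (le_max_right n k) hp))⟩)

variable {X : Endofunctor.Coalgebra (moduleTensor M)} {q : ∀ c : Complex M, X.V.obj (c.obj 0)}

theorem CellSpace.isClosed_iff {a : A} {C : Set (CellSpace X q a)} :
    IsClosed C ↔ ∀ (c : Complex M) (f : c.obj 0 ⟶ a),
      (∀ n, ∃ p ∈ levelCell X c n 0, (X.V.map f p : CellSpace X q a) ∈ C) →
        (X.V.map f (q c) : CellSpace X q a) ∈ C := by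
  rw [← isOpen_compl_iff]
  change Cᶜᶜ ∈ {C | _} ↔ _
  rw [compl_compl]
  rfl

theorem CellSpace.mem_of_isClosed {c : Complex M} {C : Set (CellSpace X q (c.obj 0))}
    (hC : IsClosed C) (h : ∀ n, ∃ p ∈ levelCell X c n 0, p ∈ C) : q c ∈ C := by
  have := CellSpace.isClosed_iff.1 hC c (𝟙 _) fun n => by
    obtain ⟨p, hp, hpC⟩ := h n
    exact ⟨p, hp, by simpa using hpC⟩
  simpa using this

/-- An ultrafilter contains a cell of each level, hence by König's lemma all cells along some
complex `c`; it then converges to `q c`. -/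
theorem CellSpace.compactSpace (hM : IsEquationalSystem M) (a : A) :
    CompactSpace (CellSpace X q a) := by
  refine ⟨isCompact_iff_ultrafilter_le_nhds.2 fun F _ => ?_⟩
  obtain ⟨c, rfl, hc⟩ := exists_complex_of_forall_trunc hM
    (fun n c => (truncCell X c : Set (CellSpace X q a)) ∈ F)
    (fun n c hx => Filter.mem_of_superset hx (truncCell_subset_init c))
    (fun n => by
      have := hM.finite_truncComplex n a
      exact (Ultrafilter.eventually_exists_iff (f := F)
        (P := fun (c : TruncComplex M n a) (x : CellSpace X q a) => x ∈ truncCell X c)).1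
        (Filter.Eventually.of_forall fun x => exists_mem_truncCell n x))
  refine ⟨q c, trivial, le_nhds_iff.2 fun O hq hO => ?_⟩
  by_contra hOF
  have hOF' : Oᶜ ∈ F := Ultrafilter.compl_mem_iff_notMem.2 hOF
  refine CellSpace.mem_of_isClosed hO.isClosed_compl (fun n => ?_) hq
  obtain ⟨p, hp, hpO⟩ := F.nonempty_of_mem (Filter.inter_mem (hc n) hOF')
  rw [truncCell_trunc] at hp
  exact ⟨p, hp, hpO⟩

/-- The action of a morphism of `A` on the sets `X a`. -/
def CellSpace.map {a a' : A} (f : a ⟶ a') (x : CellSpace X q a) : CellSpace X q a' :=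
  X.V.map f x

theorem CellSpace.continuous_map {a a' : A} (f : a ⟶ a') :
    Continuous (CellSpace.map f : CellSpace X q a → CellSpace X q a') := by
  refine continuous_iff_isClosed.2 fun C hC => CellSpace.isClosed_iff.2 fun c g h => ?_
  have := CellSpace.isClosed_iff.1 hC c (g ≫ f) fun n => by
    obtain ⟨p, hp, hpC⟩ := h n
    refine ⟨p, hp, ?_⟩
    rw [Functor.map_comp]
    exact hpC
  rw [Functor.map_comp] at this
  exact this

/-- If images under `f` of points of `C` lie in all cells along `k`, then König's lemma gives a
complex `l` over `k` whose cells meet `C`, and `f (q l)` lies in all cells along `k`. -/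
theorem CellSpace.isClosedMap_map (hM : IsEquationalSystem M) (hX : TopNondegenerate X.V)
    (hthin : HasThinCells X) (hq : ∀ c n, q c ∈ levelCell X c n 0) {a a' : A} (f : a ⟶ a') :
    IsClosedMap (CellSpace.map f : CellSpace X q a → CellSpace X q a') := by
  refine fun C hC => CellSpace.isClosed_iff.2 fun c g h => ?_
  obtain ⟨l, rfl, hl⟩ := exists_complex_of_forall_trunc hM
    (fun n l => (∃ y ∈ C, y ∈ truncCell X l) ∧ l.Over f ((c.push g).trunc n))
    (fun n l hl => ⟨let ⟨y, hyC, hy⟩ := hl.1; ⟨y, hyC, truncCell_subset_init l hy⟩, by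
      rw [← Complex.init_trunc]
      exact hl.2.init⟩)
    (fun n => by
      obtain ⟨p, hp, y, hyC, hy⟩ := h n
      have hmem := mem_levelCell_push g hp
      rw [← truncCell_trunc, ← hy] at hmem
      obtain ⟨l, hl, hyl⟩ := exists_over hX hmem
      exact ⟨l, ⟨y, hyC, hyl⟩, hl⟩)
  refine ⟨q l, CellSpace.mem_of_isClosed hC fun n => ?_, hthin (c.push g)
    (Set.mem_iInter.2 fun n => (hl n).2.map_mem ?_) (Set.mem_iInter.2 fun n => ?_)⟩
  · obtain ⟨y, hyC, hy⟩ := (hl n).1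
    exact ⟨y, by rwa [← truncCell_trunc], hyC⟩
  · rw [truncCell_trunc]
    exact hq l n
  · rw [truncCell_trunc]
    exact mem_levelCell_push g (hq c n)

/-- The functor with values the spaces `CellSpace X q a`. -/
def cellFunctor (X : Endofunctor.Coalgebra (moduleTensor M))
    (q : ∀ c : Complex M, X.V.obj (c.obj 0)) : A ⥤ TopCat.{u} where
  obj a := TopCat.of (CellSpace X q a)
  map f := TopCat.ofHom ⟨CellSpace.map f, CellSpace.continuous_map f⟩
  map_id a := by
    ext x
    exact congrArg (fun k => k x) (X.V.map_id a)
  map_comp f g := by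
    ext x
    exact congrArg (fun k => k x) (X.V.map_comp f g)

/-- The change of topology does not affect the underlying set-valued functor. -/
def cellFunctorIso (X : Endofunctor.Coalgebra (moduleTensor M))
    (q : ∀ c : Complex M, X.V.obj (c.obj 0)) :
    X.V ⋙ forget TopCat ≅ cellFunctor X q ⋙ forget TopCat :=
  NatIso.ofComponents (fun _ => Iso.refl _) fun _ => rfl

/-- The structure map of `X`, with values in the tensor product with the retopologized functor. -/
def cellToTensor (X : Endofunctor.Coalgebra (moduleTensor M))
    (q : ∀ c : Complex M, X.V.obj (c.obj 0)) (a : A) (x : CellSpace X q a) :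
    Tensor (M.flip.obj a) (cellFunctor X q ⋙ forget TopCat) :=
  Tensor.map (𝟙 _) (cellFunctorIso X q).hom (toTensor X a x)

theorem cellToTensor_eq {b a : A} {m : Sector M b a} {x : X.V.obj a} {t : X.V.obj b}
    (h : Resolves X m x t) : cellToTensor X q a x =
      Tensor.mk (Y := M.flip.obj a) (X := cellFunctor X q ⋙ forget TopCat) m t := by
  unfold Resolves at h
  unfold cellToTensor
  rw [h]
  rfl

theorem continuous_cellToTensor (hres : ∀ c : Complex M, Resolves X (c.sec 0) (q c) (q c.tail))
    (a : A) : Continuous (cellToTensor X q a) := by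
  refine continuous_iff_isClosed.2 fun D hD => CellSpace.isClosed_iff.2 fun c f h => ?_
  have hD' := Tensor.isClosed_iff.1 hD _ (Sector.push f (c.sec 0))
  have := CellSpace.mem_of_isClosed (c := c.tail) hD' fun n => by
    obtain ⟨p, ⟨t, ht, hp⟩, hpD⟩ := h (n + 1)
    refine ⟨t, by rwa [levelCell_tail], ?_⟩
    have hpD' : cellToTensor X q a (X.V.map f p) ∈ D := hpD
    rwa [cellToTensor_eq (hp.map f)] at hpD'
  change cellToTensor X q a (X.V.map f (q c)) ∈ D
  rw [cellToTensor_eq ((hres c).map f)]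
  exact this

/-- The coalgebra `X` with the topology determined by its cells. -/
def cellCoalgebra (hM : IsEquationalSystem M) (hX : TopNondegenerate X.V)
    (hthin : HasThinCells X) (hq : ∀ c n, q c ∈ levelCell X c n 0)
    (hres : ∀ c : Complex M, Resolves X (c.sec 0) (q c) (q c.tail)) : TopCoalgebra M where
  obj :=
    { V := cellFunctor X q
      str :=
        { app := fun a => TopCat.ofHom ⟨cellToTensor X q a, continuous_cellToTensor hres a⟩
          naturality := fun a a' f => by
            ext x
            obtain ⟨b, m, t, h⟩ := exists_resolves (X := X) (a := a) x
            change cellToTensor X q a' (X.V.map f x) =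
              Tensor.map (M.flip.map f) (𝟙 _) (cellToTensor X q a x)
            rw [cellToTensor_eq h, cellToTensor_eq (h.map f)]
            rfl } }
  property := ⟨hX.1.of_iso (cellFunctorIso X q),
    fun _ _ f => CellSpace.isClosedMap_map hM hX hthin hq f⟩

variable {J : TopCoalgebra M}

/-- The map to `J` from `J` with the topology determined by its cells has to be the identity, since
each point of `J` is determined by its resolution.  Hence this compact topology is finer than the
topology of `J`. -/
theorem IsUniversalSolution.compactSpace (hM : IsEquationalSystem M)
    (hT : IsUniversalSolution J) (a : A) : CompactSpace (J.obj.V.obj a) := by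
  choose t ht using fun c => hT.exists_isResolution c
  let q : ∀ c : Complex M, J.obj.V.obj (c.obj 0) := fun c => t c 0
  have hq : ∀ c n, q c ∈ levelCell J.obj c n 0 := fun c n => (ht c).mem_levelCell n 0
  have hres : ∀ c : Complex M, Resolves J.obj (c.sec 0) (q c) (q c.tail) := fun c => by
    have : t c 1 = t c.tail 0 :=
      hT.isResolution_unique (c := c.tail) (t := fun n => t c (n + 1)) (fun n => ht c (n + 1))
        (ht c.tail) 0
    have h := ht c 0
    rw [Resolves] at h
    exact h.trans (congrArg _ this)
  let K := cellCoalgebra hM J.property (hT.hasThinCells hM) hq hres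
  let ω : K ⟶ J := hT.some.from K
  have hω : ∀ x : CellSpace J.obj q a, ω.hom.f.app a x = x := by
    intro x
    obtain ⟨c, s, f, hs, rfl⟩ := SelfSim.exists_isResolution (X := J.obj) (a := a) x
    have hs' : IsResolution K.obj c s := fun n => cellToTensor_eq (hs n)
    refine (NatTrans.naturality_apply ω.hom.f f (s 0)).trans ?_
    exact congrArg (J.obj.V.map f) (hT.isResolution_unique (hs'.hom ω.hom) hs 0)
  have := CellSpace.compactSpace (X := J.obj) (q := q) hM a
  exact Function.Surjective.compactSpace (X := CellSpace J.obj q a) (f := ω.hom.f.app a)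
    (ω.hom.f.app a).hom.continuous (fun x => ⟨x, hω x⟩)

end Compact

end SelfSim

theorem theorem8p4 {A : Type u} [SmallCategory A] (M : Aᵒᵖ ⥤ A ⥤ Type u)
    (hM : SelfSim.IsEquationalSystem M) (J : SelfSim.TopCoalgebra M)
    (hJ : SelfSim.IsFixedPoint J) :
    List.TFAE
      [SelfSim.IsUniversalSolution J,
       SelfSim.Occupied J ∧ ∀ a : A, CompactSpace ((SelfSim.carrier J).obj a) ∧
         SelfSim.HasShrinkingMetric J hJ a,
       SelfSim.Occupied J ∧ (∀ a : A, CompactSpace ((SelfSim.carrier J).obj a)) ∧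
         ∀ c : SelfSim.Complex M, (⋂ n : ℕ, SelfSim.cell J hJ (c.trunc n)).Subsingleton] := by
  simp only [SelfSim.cell_eq_truncCell]
  tfae_have 1 → 3 := fun h => ⟨h.occupied, h.compactSpace hM, h.hasThinCells hM⟩
  tfae_have 3 → 1 := fun h =>
    SelfSim.isUniversalSolution_of_hasThinCells hM hJ h.1 h.2.1 h.2.2
  tfae_have 3 → 2 := fun h => ⟨h.1, fun a =>
    ⟨h.2.1 a, SelfSim.hasShrinkingMetric_of_hasThinCells hM hJ h.2.1 h.2.2 a⟩⟩
  tfae_have 2 → 3 := fun h => ⟨h.1, fun a => (h.2 a).1,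
    SelfSim.hasThinCells_of_hasShrinkingMetric hJ fun a => (h.2 a).2⟩
  tfae_finish
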